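/- A lattice path is a path in $\mathbb{Z}^2$ starting at $(0,0)$ with steps $E=(1,0)$ and $N=(0,1)$, written as a word in the letters $E,N$. Let $P$ and $Q$ be lattice paths with a common endpoint $(m,r)$ such that $P$ never goes above $Q$. For $1\le i\le r$ let $N_i$ be the set of all $j$ such that step $j$ is the $i$-th North step of some lattice path from $(0,0)$ to $(m,r)$ that goes neither above $Q$ nor below $P$. Let $M[P,Q]$ be the transversal matroid on the ground set $\{1,2,\ldots,m+r\}$ with presentation $(N_1,\ldots,N_r)$. For a word $w=s_1s_2\cdots s_n$ let $w^\rho=s_n\cdots s_2s_1$. **Theorem 5.5.** Assume that the matroid $M[P,Q]$ is connected. Then the paths $P$ and $Q$ are determined by the matroid up to a $180^\circ$ rotation. That is, for words $P^*,Q^*$ in the letters $E,N$ the following are equivalent: 1. $P^*$ and $Q^*$ are lattice paths with a common endpoint, $P^*$ never goes above $Q^*$, and $M[P^*,Q^*]\cong M[P,Q]$; 2. $(P^*,Q^*)=(P,Q)$ or $(P^*,Q^*)=(Q^\rho,P^\rho)$. -/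

import Mathlib

namespace LatticePath

/-! ### Matroid notions -/

/-- A partial transversal of the family `A`: a set `I` whose elements can be assigned to pairwise
distinct indices `i` so that each element lies in the set `A i` it is assigned to. -/
def IsPartialTransversal {α ι : Type*} (A : ι → Set α) (I : Set α) : Prop :=
  ∃ f : I → ι, Function.Injective f ∧ ∀ x : I, (x : α) ∈ A (f x)

theorem isPartialTransversal_iff {α ι : Type*} [Nonempty ι] (A : ι → Set α) (I : Set α) :
    IsPartialTransversal A I ↔ ∃ f : α → ι, Set.InjOn f I ∧ ∀ x ∈ I, x ∈ A (f x) := by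
  classical
  constructor
  · rintro ⟨f, hf, hA⟩
    refine ⟨fun x => if h : x ∈ I then f ⟨x, h⟩ else Classical.arbitrary ι, ?_, ?_⟩
    · intro x hx y hy hxy
      simp only [dif_pos hx, dif_pos hy] at hxy
      exact congrArg Subtype.val (hf hxy)
    · intro x hx
      simp only [dif_pos hx]
      exact hA ⟨x, hx⟩
  · rintro ⟨f, hf, hA⟩
    exact ⟨fun x => f x, fun x y h => Subtype.ext (hf x.2 y.2 h), fun x => hA x x.2⟩

theorem IsPartialTransversal.empty {α ι : Type*} (A : ι → Set α) :
    IsPartialTransversal A ∅ :=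
  ⟨fun x => x.2.elim, fun x => x.2.elim, fun x => x.2.elim⟩

theorem IsPartialTransversal.subset {α ι : Type*} {A : ι → Set α} {I J : Set α}
    (hJ : IsPartialTransversal A J) (hIJ : I ⊆ J) : IsPartialTransversal A I := by
  obtain ⟨f, hf, hA⟩ := hJ
  exact ⟨f ∘ Set.inclusion hIJ, hf.comp (Set.inclusion_injective hIJ),
    fun x => hA (Set.inclusion hIJ x)⟩

/-- The augmentation property of partial transversals. -/
theorem IsPartialTransversal.augment {α ι : Type*} {A : ι → Set α} {I J : Set α}
    (hI : IsPartialTransversal A I) (hIfin : I.Finite) (hJ : IsPartialTransversal A J)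
    (hJfin : J.Finite) (hlt : I.ncard < J.ncard) :
    ∃ e ∈ J, e ∉ I ∧ IsPartialTransversal A (insert e I) := by
  classical
  have hne : J.Nonempty := by
    rw [← Set.ncard_pos hJfin]; omega
  have hι : Nonempty ι := by
    obtain ⟨f, -⟩ := hJ
    exact ⟨f ⟨_, hne.some_mem⟩⟩
  obtain ⟨g, hg, hgA⟩ := (isPartialTransversal_iff A J).1 hJ
  by_contra! hcon
  -- No matching of `I` has the largest number of agreements with `g`.
  have key : ∀ n : ℕ, ∃ f : α → ι, Set.InjOn f I ∧ (∀ x ∈ I, x ∈ A (f x)) ∧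
      n ≤ {x ∈ I | f x = g x}.ncard := by
    intro n
    induction n with
    | zero =>
      obtain ⟨f, hf, hfA⟩ := (isPartialTransversal_iff A I).1 hI
      exact ⟨f, hf, hfA, Nat.zero_le _⟩
    | succ n ih =>
      obtain ⟨f, hf, hfA, hn⟩ := ih
      obtain ⟨i, hiJ, hiI⟩ : ∃ i ∈ g '' J, i ∉ f '' I := by
        by_contra! hsub
        have h := Set.ncard_le_ncard hsub (hIfin.image f)
        rw [hg.ncard_image, hf.ncard_image] at h
        omega
      obtain ⟨y, hyJ, rfl⟩ := hiJ
      have hfy : ∀ x ∈ I, f x ≠ g y := fun x hx h => hiI ⟨x, hx, h⟩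
      have hupA : ∀ x ∈ insert y I, x ∈ A (Function.update f y (g y) x) := by
        intro x hx
        by_cases hxy : x = y
        · subst hxy; simpa using hgA x hyJ
        · simpa [hxy] using hfA x (hx.resolve_left hxy)
      have hupinj : Set.InjOn (Function.update f y (g y)) (insert y I) := by
        intro a ha b hb hab
        by_cases hay : a = y <;> by_cases hby : b = y
        · rw [hay, hby]
        · subst hay
          have hbI := hb.resolve_left hby
          simp [hby] at hab
          exact absurd hab.symm (hfy b hbI)
        · subst hby
          have haI := ha.resolve_left hay
          simp [hay] at hab
          exact absurd hab (hfy a haI)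
        · simp [hay, hby] at hab
          exact hf (ha.resolve_left hay) (hb.resolve_left hby) hab
      have hyI : y ∈ I := by
        by_contra hyI
        exact hcon y hyJ hyI ((isPartialTransversal_iff A _).2 ⟨_, hupinj, hupA⟩)
      refine ⟨Function.update f y (g y), hupinj.mono (Set.subset_insert y I),
        fun x hx => hupA x (Set.mem_insert_of_mem y hx), ?_⟩
      have hss : {x ∈ I | f x = g x} ⊂ {x ∈ I | Function.update f y (g y) x = g x} := by
        refine ⟨fun x hx => ⟨hx.1, ?_⟩, fun h => ?_⟩
        · by_cases hxy : x = y
          · subst hxy; simp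
          · simpa [hxy] using hx.2
        · exact hfy y hyI (h ⟨hyI, by simp⟩).2
      have := Set.ncard_lt_ncard hss (hIfin.subset (Set.sep_subset _ _))
      omega
  obtain ⟨f, -, -, hn⟩ := key (I.ncard + 1)
  have := Set.ncard_le_ncard (Set.sep_subset I fun x => f x = g x) hIfin
  omega

/-- The transversal matroid on the finite ground set `E` with presentation `A`: its independent
sets are the partial transversals of `A` (contained in `E`), so that its bases are the maximal
ones. -/
def transversalMatroid {α ι : Type*} (E : Finset α) (A : ι → Set α) : Matroid α :=
  (IndepMatroid.ofFinite (E := (E : Set α)) E.finite_toSet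
    (fun I => I ⊆ (E : Set α) ∧ IsPartialTransversal A I)
    ⟨Set.empty_subset _, IsPartialTransversal.empty A⟩
    (fun _ _ hJ hIJ => ⟨hIJ.trans hJ.1, hJ.2.subset hIJ⟩)
    (fun _ _ hI hJ hlt => by
      obtain ⟨e, heJ, heI, he⟩ := hI.2.augment (E.finite_toSet.subset hI.1) hJ.2
        (E.finite_toSet.subset hJ.1) hlt
      exact ⟨e, heJ, heI, Set.insert_subset (hJ.1 heJ) hI.1, he⟩)
    (fun _ hI => hI.1)).matroid

@[simp] theorem transversalMatroid_ground {α ι : Type*} (E : Finset α) (A : ι → Set α) :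
    (transversalMatroid E A).E = (E : Set α) := rfl

@[simp] theorem transversalMatroid_indep_iff {α ι : Type*} (E : Finset α) (A : ι → Set α)
    (I : Set α) :
    (transversalMatroid E A).Indep I ↔ I ⊆ (E : Set α) ∧ IsPartialTransversal A I := Iff.rfl

/-- A matroid is connected if any two distinct elements lie in a common circuit. -/
def IsConnected {α : Type*} (M : Matroid α) : Prop :=
  ∀ x ∈ M.E, ∀ y ∈ M.E, x ≠ y → ∃ C, M.IsCircuit C ∧ x ∈ C ∧ y ∈ C

/-- Two matroids are isomorphic if there is a bijection between their ground sets under which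
independent sets correspond to independent sets. -/
def IsIsomorphic {α β : Type*} (M : Matroid α) (N : Matroid β) : Prop :=
  ∃ e : M.E ≃ N.E, ∀ I : Set M.E,
    M.Indep ((fun x : M.E => (x : α)) '' I) ↔ N.Indep ((fun x : M.E => (e x : β)) '' I)

/-! ### Lattice paths -/

/-- The two kinds of step: East `(1, 0)` and North `(0, 1)`. -/
inductive Step : Type
  | east : Step
  | north : Step
  deriving DecidableEq

/-- The endpoint `(x, y)` of the lattice path that starts at `(0, 0)` and has step word `w`. -/
def endpoint (w : List Step) : ℕ × ℕ := (w.count Step.east, w.count Step.north)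

/-- For lattice paths `P`, `Q` with the same endpoint, this says that `P` never goes above `Q`.
After `k` steps both paths are on the line `x + y = k`, and the point reached by `P` must be
at most as high on this line as the point reached by `Q`. -/
def NeverAbove (P Q : List Step) : Prop :=
  ∀ k : ℕ, (endpoint (P.take k)).2 ≤ (endpoint (Q.take k)).2

/-- `P` and `Q` are lattice paths from `(0, 0)` to a common point `(m, r)`, and `P` never goes
above `Q`. -/
def IsBoundingPair (P Q : List Step) : Prop :=
  endpoint P = endpoint Q ∧ NeverAbove P Q

/-- The lattice paths with the same endpoint as `P` (and `Q`) that go neither above `Q` nor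
below `P`. -/
def pathsBetween (P Q : List Step) : Set (List Step) :=
  {R | endpoint R = endpoint P ∧ NeverAbove P R ∧ NeverAbove R Q}

/-- Step `j` of the path `R` is the `i`-th North step of `R` (both counted from `1`). -/
def IsNorthStep (R : List Step) (i j : ℕ) : Prop :=
  1 ≤ j ∧ R[j - 1]? = some Step.north ∧ (R.take j).count Step.north = i

/-- The set `N_i` of all `j` such that step `j` is the `i`-th North step of some path between
`P` and `Q`. -/
def northSet (P Q : List Step) (i : ℕ) : Set ℕ :=
  {j | ∃ R ∈ pathsBetween P Q, IsNorthStep R i j}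

/-- The matroid `M[P, Q]`: if `P` and `Q` end at `(m, r)`, it is the transversal matroid on the
ground set `{1, …, m + r}` with presentation `(N_1, …, N_r)`. -/
def latticePathMatroid (P Q : List Step) : Matroid ℕ :=
  transversalMatroid (Finset.Icc 1 ((endpoint P).1 + (endpoint P).2))
    (fun i : Set.Icc 1 (endpoint P).2 => northSet P Q i)

end LatticePath

namespace LatticePath

open Set

/-! Let `p ≤ q` be the heights of `P` and `Q`. Step `j` can be the `i`-th North step exactly when `p
(j - 1) < i ≤ q j` (`northSet_eq`), so each element sees an interval of indices whose two ends grow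
with `j`. By Hall's theorem a circuit with least element `a` and greatest element `b` sees exactly
the indices in `(p (a - 1), q b]`, one fewer than its size, and its closure consists of the elements
whose interval lies inside this one (`exists_of_isCircuit`).

Connectedness forces `p < q` strictly between the endpoints. Then every fundamental flat, a notion
invariant under isomorphism, is an initial or a final interval of the ground set, with rank read off
from `q` or `p` (`eq_of_isFundamentalFlat`). Conversely, each East-North corner of `Q` gives an
initial flat, and by rotation each North-East corner of `P` gives a final one.

Inclusion makes the flats two chains, with no comparabilities between them, so an isomorphism
preserves or exchanges the chains. It keeps sizes and ranks, so up to rotation the second pair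
passes through all these corners of the first, and hence lies between `P` and `Q`
(`le_or_le_reverse`). The same argument with the roles exchanged gives the opposite inequalities. -/

/-! ### Heights of lattice paths -/

/-- The height of the lattice path `w` after `k` steps. -/
def height (w : List Step) (k : ℕ) : ℕ := (w.take k).count Step.north

@[simp] theorem height_zero (w : List Step) : height w 0 = 0 := by simp [height]

theorem height_succ (w : List Step) (k : ℕ) :
    height w (k + 1) = height w k + if w[k]? = some Step.north then 1 else 0 := by
  unfold height
  rw [List.take_add_one, List.count_append]
  congr 1
  rcases h : w[k]? with _ | s
  · simp
  · cases s <;> simp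

theorem height_of_length_le {w : List Step} {k : ℕ} (h : w.length ≤ k) :
    height w k = w.count Step.north := by
  rw [height, List.take_of_length_le h]

theorem height_mono (w : List Step) : Monotone (height w) :=
  monotone_nat_of_le_succ fun k => by rw [height_succ]; omega

theorem height_succ_le (w : List Step) (k : ℕ) : height w (k + 1) ≤ height w k + 1 := by
  rw [height_succ]; split_ifs <;> omega

theorem endpoint_sum (w : List Step) : (endpoint w).1 + (endpoint w).2 = w.length := by
  induction w with
  | nil => rfl
  | cons s w ih => cases s <;> simp [endpoint] at ih ⊢ <;> omega

theorem getElem?_eq_north_iff (w : List Step) (k : ℕ) :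
    w[k]? = some Step.north ↔ height w k < height w (k + 1) := by
  rw [height_succ]; split_ifs with h <;> simp [h]

theorem ext_height {v w : List Step} (hlen : v.length = w.length)
    (h : ∀ k, height v k = height w k) : v = w := by
  refine List.ext_getElem hlen fun k hk hk' => ?_
  have : v[k]? = some Step.north ↔ w[k]? = some Step.north := by
    rw [getElem?_eq_north_iff, getElem?_eq_north_iff, h, h]
  rw [List.getElem?_eq_getElem hk, List.getElem?_eq_getElem hk'] at this
  cases hv : v[k] <;> cases hw : w[k] <;> simp [hv, hw] at this ⊢

theorem endpoint_eq_iff {v w : List Step} :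
    endpoint v = endpoint w ↔
      v.length = w.length ∧ v.count Step.north = w.count Step.north := by
  rw [← endpoint_sum, ← endpoint_sum, Prod.ext_iff]
  simp only [endpoint]
  omega

theorem neverAbove_iff {P Q : List Step} : NeverAbove P Q ↔ ∀ k, height P k ≤ height Q k :=
  Iff.rfl

theorem exists_height_eq (n : ℕ) {f : ℕ → ℕ} (h0 : f 0 = 0) (hmono : Monotone f)
    (hstep : ∀ k, f (k + 1) ≤ f k + 1) :
    ∃ w : List Step, w.length = n ∧ ∀ k ≤ n, height w k = f k := by
  refine ⟨(List.range n).map fun k => if f k < f (k + 1) then Step.north else Step.east,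
    by simp, fun k => ?_⟩
  induction k with
  | zero => simp [h0]
  | succ k ih =>
    intro hk
    have h1 := hmono (Nat.le_succ k)
    have h2 := hstep k
    rw [height_succ, ih (by omega)]
    simp only [List.getElem?_map, List.getElem?_range (show k < n by omega), Option.map_some,
      Nat.succ_eq_add_one, Option.some.injEq] at h1 ⊢
    by_cases h : f k < f (k + 1) <;> simp [h] <;> omega

theorem height_reverse_add (w : List Step) (k : ℕ) :
    height w.reverse k + height w (w.length - k) = w.count Step.north := by
  rw [height, height, List.take_reverse, List.count_reverse, add_comm, ← List.count_append,
    List.take_append_drop]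

theorem endpoint_reverse (w : List Step) : endpoint w.reverse = endpoint w := by
  simp [endpoint]

/-! ### Matroids presented by bands of intervals -/

/-- The functions `p ≤ q` are the heights of two lattice paths from `(0, 0)` to a common point at
height `r`, reached after `n` steps. -/
structure IsBand (n r : ℕ) (p q : ℕ → ℕ) : Prop where
  p_zero : p 0 = 0
  q_zero : q 0 = 0
  p_eq : ∀ k, n ≤ k → p k = r
  q_eq : ∀ k, n ≤ k → q k = r
  p_mono : Monotone p
  q_mono : Monotone q
  p_succ_le : ∀ k, p (k + 1) ≤ p k + 1
  q_succ_le : ∀ k, q (k + 1) ≤ q k + 1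
  le : ∀ k, p k ≤ q k

/-- The indices `i` of the sets of the presentation that contain `j`. -/
def nbhd (p q : ℕ → ℕ) (j : ℕ) : Finset ℕ := Finset.Ioc (p (j - 1)) (q j)

/-- The transversal matroid on `{1, …, n}` in which `j` belongs to the sets of the presentation
with indices `i` in the interval `p (j - 1) < i ≤ q j`. -/
def bandMatroid (n : ℕ) (p q : ℕ → ℕ) : Matroid ℕ :=
  transversalMatroid (Finset.Icc 1 n) (fun i : ℕ => {j | i ∈ nbhd p q j})

theorem IsBoundingPair.isBand {P Q : List Step} (h : IsBoundingPair P Q) :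
    IsBand P.length (P.count Step.north) (height P) (height Q) := by
  obtain ⟨h1, h2⟩ := h
  rw [endpoint_eq_iff] at h1
  exact ⟨height_zero _, height_zero _, fun _ hk => height_of_length_le hk,
    fun k _ => by rw [height_of_length_le (by omega), h1.2], height_mono _, height_mono _,
    height_succ_le _, height_succ_le _, h2⟩

/-- A path in the band is at least at `p (j - 1)` before step `j` and at most at `q j` after it.
Conversely, a step function that jumps from `i - 1` to `i` at step `j`, clamped between `p` and `q`,
is the height of such a path. -/
theorem northSet_eq {P Q : List Step} (h : IsBoundingPair P Q) (i : ℕ) :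
    northSet P Q i = {j | j ∈ Icc 1 P.length ∧ i ∈ nbhd (height P) (height Q) j} := by
  have hB := h.isBand
  ext j
  simp only [northSet, IsNorthStep, pathsBetween, mem_ofPred_eq, nbhd, Finset.mem_Ioc, mem_Icc,
    neverAbove_iff, endpoint_eq_iff]
  constructor
  · rintro ⟨R, ⟨⟨hlen, -⟩, hPR, hRQ⟩, hj, hN, hi⟩
    obtain ⟨j, rfl⟩ := Nat.exists_eq_add_of_le' hj
    have hi' : height R (j + 1) = i := hi
    rw [Nat.add_sub_cancel] at hN ⊢
    have hjl : j < R.length := by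
      by_contra hcon
      rw [List.getElem?_eq_none (by omega)] at hN
      simp at hN
    rw [getElem?_eq_north_iff] at hN
    have := hPR j
    have := hRQ (j + 1)
    exact ⟨⟨hj, by omega⟩, by omega, by omega⟩
  · rintro ⟨⟨hj, hjn⟩, h1, h2⟩
    obtain ⟨j, rfl⟩ := Nat.exists_eq_add_of_le' hj
    rw [Nat.add_sub_cancel] at h1
    set p := height P
    set q := height Q
    obtain ⟨R, hlen, hR⟩ := exists_height_eq P.length
      (f := fun k => max (p k) (min (q k) (if k ≤ j then i - 1 else i)))
      (by simp [hB.p_zero, hB.q_zero])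
      (monotone_nat_of_le_succ fun k => by
        have := hB.p_mono (Nat.le_succ k)
        have := hB.q_mono (Nat.le_succ k)
        simp only [Nat.succ_eq_add_one] at *
        split_ifs <;> omega)
      (fun k => by
        have := hB.p_succ_le k
        have := hB.q_succ_le k
        split_ifs <;> omega)
    have hRtop : height R P.length = P.count Step.north := by
      have := hB.p_eq _ le_rfl
      have := hB.q_eq _ le_rfl
      rw [hR _ le_rfl]
      split_ifs <;> omega
    have hRk : ∀ k, p k ≤ height R k ∧ height R k ≤ q k := by
      intro k
      rcases le_total k P.length with hk | hk
      · have := hB.le k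
        rw [hR k hk]
        constructor <;> omega
      · have : height R k = P.count Step.north := by
          rw [← hRtop, height_of_length_le hlen.le, height_of_length_le (by omega)]
        rw [hB.p_eq k hk, hB.q_eq k hk, this]
        simp
    have e1 : height R j = i - 1 := by
      have := hB.q_succ_le j
      rw [hR j (by omega)]
      simp only [le_refl, if_true]
      omega
    have e2 : height R (j + 1) = i := by
      have := hB.p_succ_le j
      rw [hR _ hjn, if_neg (by omega)]
      omega
    refine ⟨R, ⟨⟨hlen, ?_⟩, fun k => (hRk k).1, fun k => (hRk k).2⟩, hj, ?_, e2⟩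
    · rw [← hRtop, height_of_length_le hlen.le]
    · rw [Nat.add_sub_cancel, getElem?_eq_north_iff]
      omega

theorem bandMatroid_indep_iff (n : ℕ) (p q : ℕ → ℕ) (I : Set ℕ) :
    (bandMatroid n p q).Indep I ↔
      I ⊆ Icc 1 n ∧ ∃ f : ℕ → ℕ, InjOn f I ∧ ∀ x ∈ I, f x ∈ nbhd p q x := by
  rw [bandMatroid, transversalMatroid_indep_iff, isPartialTransversal_iff, Finset.coe_Icc]
  rfl

@[simp] theorem bandMatroid_ground (n : ℕ) (p q : ℕ → ℕ) : (bandMatroid n p q).E = Icc 1 n := by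
  rw [bandMatroid, transversalMatroid_ground, Finset.coe_Icc]

/-- `bandMatroid` indexes its presentation by all of `ℕ`; the extra indices are harmless, because
elements of the ground set only see indices between `1` and `r`. -/
theorem latticePathMatroid_eq {P Q : List Step} (h : IsBoundingPair P Q) :
    latticePathMatroid P Q = bandMatroid P.length (height P) (height Q) := by
  have hB := h.isBand
  refine Matroid.ext_indep ?_ fun I hI => ?_
  · rw [latticePathMatroid, transversalMatroid_ground, endpoint_sum, bandMatroid_ground,
      Finset.coe_Icc]
  rw [latticePathMatroid, transversalMatroid_indep_iff, bandMatroid_indep_iff, endpoint_sum,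
    Finset.coe_Icc]
  refine and_congr_right fun hI => ?_
  constructor
  · rintro ⟨f, hf, hfA⟩
    have : ∃ f : I → ℕ, f.Injective ∧ ∀ x : I, f x ∈ nbhd (height P) (height Q) x := by
      refine ⟨fun x => f x, Subtype.val_injective.comp hf, fun x => ?_⟩
      have := hfA x
      simp only [northSet_eq h] at this
      exact this.2
    exact (isPartialTransversal_iff (fun i : ℕ => {j | i ∈ nbhd (height P) (height Q) j}) I).1 this
  · rintro ⟨f, hf, hfA⟩
    have hmem : ∀ x : I, f x ∈ Icc 1 (endpoint P).2 := by
      intro x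
      have h1 := hfA x x.2
      have h2 := (hI x.2).2
      simp only [nbhd, Finset.mem_Ioc] at h1
      have h3 := hB.q_mono h2
      rw [hB.q_eq _ le_rfl] at h3
      simp only [endpoint, mem_Icc]
      omega
    refine ⟨fun x => ⟨f x, hmem x⟩, fun x y hxy => ?_, fun x => ?_⟩
    · exact Subtype.ext (hf x.2 y.2 (congrArg Subtype.val hxy))
    · simp only [northSet_eq h]
      exact ⟨hI x.2, hfA x x.2⟩

/-- The indices of the sets of the presentation that meet `X`. -/
def nbhds (p q : ℕ → ℕ) (X : Finset ℕ) : Finset ℕ := X.biUnion (nbhd p q)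

theorem mem_nbhd {p q : ℕ → ℕ} {i j : ℕ} : i ∈ nbhd p q j ↔ p (j - 1) < i ∧ i ≤ q j :=
  Finset.mem_Ioc

theorem mem_nbhds {p q : ℕ → ℕ} {X : Finset ℕ} {i : ℕ} :
    i ∈ nbhds p q X ↔ ∃ j ∈ X, p (j - 1) < i ∧ i ≤ q j := by
  simp [nbhds, mem_nbhd]

theorem nbhds_mono {p q : ℕ → ℕ} {X Y : Finset ℕ} (h : X ⊆ Y) : nbhds p q X ⊆ nbhds p q Y :=
  Finset.biUnion_subset_biUnion_of_subset_left _ h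

/-- Hall's marriage theorem. -/
theorem bandMatroid_indep_coe_iff (n : ℕ) (p q : ℕ → ℕ) (I : Finset ℕ) :
    (bandMatroid n p q).Indep I ↔
      (I : Set ℕ) ⊆ Icc 1 n ∧ ∀ Y ⊆ I, Y.card ≤ (nbhds p q Y).card := by
  classical
  rw [bandMatroid_indep_iff]
  refine and_congr_right fun hI => ?_
  constructor
  · rintro ⟨f, hf, hfA⟩ Y hY
    refine Finset.card_le_card_of_injOn f (fun x hx => ?_) (hf.mono (by exact_mod_cast hY))
    exact Finset.mem_biUnion.2 ⟨x, hx, hfA x (hY hx)⟩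
  · intro hY
    have := (Finset.all_card_le_biUnion_card_iff_exists_injective
      (fun x : (I : Set ℕ) => nbhd p q x)).1 (fun s => by
        have := hY (s.map (Function.Embedding.subtype _)) (fun x hx => by
          obtain ⟨y, -, rfl⟩ := Finset.mem_map.1 hx
          exact y.2)
        rw [Finset.card_map] at this
        refine this.trans (Finset.card_le_card fun i hi => ?_)
        obtain ⟨j, hj, hi⟩ := Finset.mem_biUnion.1 hi
        obtain ⟨y, hy, rfl⟩ := Finset.mem_map.1 hj
        exact Finset.mem_biUnion.2 ⟨y, hy, hi⟩)
    exact (isPartialTransversal_iff (fun i : ℕ => {j | i ∈ nbhd p q j}) (I : Set ℕ)).1 this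


/-! ### Circuits and their closures -/

section Circuits

variable {n r : ℕ} {p q : ℕ → ℕ}

theorem exists_finset_eq_of_subset_ground {X : Set ℕ} (hX : X ⊆ (bandMatroid n p q).E) :
    ∃ Y : Finset ℕ, (Y : Set ℕ) = X := by
  rw [bandMatroid_ground] at hX
  exact ((finite_Icc 1 n).subset hX).exists_finset_coe

theorem card_le_card_nbhds {I : Finset ℕ} (hI : (bandMatroid n p q).Indep I) :
    I.card ≤ (nbhds p q I).card :=
  ((bandMatroid_indep_coe_iff n p q I).1 hI).2 I subset_rfl

/-- Hall's condition fails on some subset of `D`, which by minimality is `D` itself; it holds again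
after deleting one element, so the deficiency is exactly one. -/
theorem card_nbhds_add_one {D : Finset ℕ} (hD : (bandMatroid n p q).IsCircuit D) :
    (nbhds p q D).card + 1 = D.card := by
  have hE : (D : Set ℕ) ⊆ Icc 1 n := by simpa using hD.subset_ground
  have h1 := hD.not_indep
  rw [bandMatroid_indep_coe_iff] at h1
  push Not at h1
  obtain ⟨Y, hYD, hY⟩ := h1 hE
  have hYeq : (Y : Set ℕ) = D := hD.eq_of_not_indep_subset
    (fun h => by have := card_le_card_nbhds h; omega) (by exact_mod_cast hYD)
  rw [Finset.coe_inj] at hYeq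
  subst hYeq
  obtain ⟨d, hd⟩ := hD.nonempty
  have h2 : (bandMatroid n p q).Indep (Y.erase d : Finset ℕ) := by
    rw [Finset.coe_erase]
    exact hD.sdiff_singleton_indep hd
  have h3 := card_le_card_nbhds h2
  have h4 := Finset.card_le_card (nbhds_mono (p := p) (q := q) (Y.erase_subset d))
  have h5 := Finset.card_erase_add_one (Finset.mem_coe.1 hd)
  omega

/-- Both parts are independent, so disjoint neighbourhoods would supply at least `D.card` indices,
one more than a circuit has. -/
theorem not_disjoint_nbhds_of_isCircuit {D D₁ D₂ : Finset ℕ}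
    (hD : (bandMatroid n p q).IsCircuit D) (h₁ : D₁ ⊂ D) (h₂ : D₂ ⊂ D) (h : D ⊆ D₁ ∪ D₂) :
    ¬ Disjoint (nbhds p q D₁) (nbhds p q D₂) := by
  intro hdisj
  have c1 := card_le_card_nbhds (hD.ssubset_indep (Finset.coe_ssubset.2 h₁))
  have c2 := card_le_card_nbhds (hD.ssubset_indep (Finset.coe_ssubset.2 h₂))
  have c3 := card_nbhds_add_one hD
  have c4 := Finset.card_le_card h
  have c5 := Finset.card_union_le D₁ D₂
  have c6 := Finset.card_union_of_disjoint hdisj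
  have c7 : (nbhds p q D₁ ∪ nbhds p q D₂).card ≤ (nbhds p q D).card :=
    Finset.card_le_card (Finset.union_subset (nbhds_mono h₁.1) (nbhds_mono h₂.1))
  omega

/-- A matching of `D` minus one element uses up all of `nbhds p q D`. Hence a further element can be
matched exactly when it sees an index outside this set. -/
theorem mem_closure_isCircuit_iff {D : Finset ℕ} (hD : (bandMatroid n p q).IsCircuit D) (y : ℕ) :
    y ∈ (bandMatroid n p q).closure D ↔ y ∈ Icc 1 n ∧ nbhd p q y ⊆ nbhds p q D := by
  classical
  have hE : (D : Set ℕ) ⊆ Icc 1 n := by simpa using hD.subset_ground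
  obtain ⟨d, hd⟩ := hD.nonempty
  have hcard := card_nbhds_add_one hD
  have hcoe : ((D.erase d : Finset ℕ) : Set ℕ) = (D : Set ℕ) \ {d} := Finset.coe_erase d D
  have hind : (bandMatroid n p q).Indep (D.erase d : Finset ℕ) := by
    rw [hcoe]; exact hD.sdiff_singleton_indep hd
  rw [← hD.closure_sdiff_singleton_eq d, ← hcoe]
  constructor
  · intro hy
    have hyE : y ∈ Icc 1 n := by
      simpa using (bandMatroid n p q).closure_subset_ground _ hy
    refine ⟨hyE, fun i hi => ?_⟩
    by_contra hiD
    have hyD : y ∉ D := fun h => hiD (Finset.mem_biUnion.2 ⟨y, h, hi⟩)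
    have hdep := (hind.mem_closure_iff_of_notMem
      (fun h => hyD (Finset.mem_of_mem_erase (Finset.mem_coe.1 h)))).1 hy
    refine hdep.not_indep ?_
    rw [bandMatroid_indep_iff] at hind ⊢
    obtain ⟨hsub, f, hf, hfA⟩ := hind
    have hne : ∀ x ∈ ((D.erase d : Finset ℕ) : Set ℕ), x ≠ y ∧ f x ≠ i := by
      intro x hx
      have hxD : x ∈ D := Finset.mem_of_mem_erase (Finset.mem_coe.1 hx)
      exact ⟨fun h => hyD (h ▸ hxD),
        fun h => hiD (Finset.mem_biUnion.2 ⟨x, hxD, h ▸ hfA x hx⟩)⟩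
    refine ⟨insert_subset hyE hsub, Function.update f y i, ?_, ?_⟩
    · rw [injOn_insert fun h => (hne y h).1 rfl]
      refine ⟨fun a ha b hb hab => ?_, ?_⟩
      · rw [Function.update_of_ne (hne a ha).1, Function.update_of_ne (hne b hb).1] at hab
        exact hf ha hb hab
      · rintro ⟨x, hx, hxy⟩
        rw [Function.update_of_ne (hne x hx).1, Function.update_self] at hxy
        exact (hne x hx).2 hxy
    · rintro x (rfl | hx)
      · rwa [Function.update_self]
      · rw [Function.update_of_ne (hne x hx).1]
        exact hfA x hx
  · rintro ⟨hyE, hy⟩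
    rw [hcoe, hD.closure_sdiff_singleton_eq d]
    by_cases hyD : y ∈ D
    · exact (bandMatroid n p q).mem_closure_of_mem hyD hD.subset_ground
    rw [← hD.closure_sdiff_singleton_eq d, ← hcoe]
    have hyD' : y ∉ D.erase d := fun h => hyD (Finset.mem_of_mem_erase h)
    rw [hind.mem_closure_iff_of_notMem (by exact_mod_cast hyD'), Matroid.dep_iff]
    have hsub : insert y ((D.erase d : Finset ℕ) : Set ℕ) ⊆ Icc 1 n :=
      insert_subset hyE ((Finset.coe_subset.2 (D.erase_subset d)).trans hE)
    refine ⟨fun h => ?_, by simpa using hsub⟩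
    rw [← Finset.coe_insert] at h
    have c1 := card_le_card_nbhds h
    rw [Finset.card_insert_of_notMem hyD', Finset.card_erase_add_one hd] at c1
    have c2 : nbhds p q (insert y (D.erase d)) ⊆ nbhds p q D := by
      intro i hi
      obtain ⟨j, hj, hij⟩ := Finset.mem_biUnion.1 hi
      rcases Finset.mem_insert.1 hj with rfl | hj
      · exact hy hij
      · exact Finset.mem_biUnion.2 ⟨j, Finset.mem_of_mem_erase hj, hij⟩
    have := Finset.card_le_card c2
    omega

theorem IsBand.nbhds_subset_Ioc (hB : IsBand n r p q) {X : Finset ℕ} {a b : ℕ}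
    (h : ∀ x ∈ X, a ≤ x ∧ x ≤ b) : nbhds p q X ⊆ Finset.Ioc (p (a - 1)) (q b) := by
  intro i hi
  obtain ⟨x, hx, h1, h2⟩ := mem_nbhds.1 hi
  have h3 := hB.p_mono (Nat.sub_le_sub_right (h x hx).1 1)
  have h4 := hB.q_mono (h x hx).2
  exact Finset.mem_Ioc.2 ⟨by omega, by omega⟩

/-- An index missing from the interval would split `D` into elements seeing only smaller indices and
elements seeing only larger ones, which a circuit does not allow. -/
theorem IsBand.nbhds_eq_Ioc (hB : IsBand n r p q) {D : Finset ℕ}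
    (hD : (bandMatroid n p q).IsCircuit D) {a b : ℕ} (ha : a ∈ D) (hb : b ∈ D)
    (hab : ∀ x ∈ D, a ≤ x ∧ x ≤ b) : nbhds p q D = Finset.Ioc (p (a - 1)) (q b) := by
  classical
  refine (hB.nbhds_subset_Ioc hab).antisymm fun i hi => ?_
  rw [Finset.mem_Ioc] at hi
  by_contra hiD
  have hor : ∀ d ∈ D, q d < i ∨ i ≤ p (d - 1) := by
    intro d hd
    by_contra! hcon
    exact hiD (mem_nbhds.2 ⟨d, hd, hcon.2, hcon.1⟩)
  refine not_disjoint_nbhds_of_isCircuit hD (D₁ := {d ∈ D | q d < i})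
    (D₂ := {d ∈ D | i ≤ p (d - 1)}) ?_ ?_ ?_ ?_
  · refine Finset.filter_ssubset.2 ⟨b, hb, by omega⟩
  · refine Finset.filter_ssubset.2 ⟨a, ha, by omega⟩
  · intro d hd
    simpa [hd] using hor d hd
  · refine Finset.disjoint_left.2 fun k h1 h2 => ?_
    obtain ⟨x, hx, hx1, hx2⟩ := mem_nbhds.1 h1
    obtain ⟨y, hy, hy1, hy2⟩ := mem_nbhds.1 h2
    rw [Finset.mem_filter] at hx hy
    omega

/-- The two paths meet only at their endpoints, and these are not adjacent. -/
structure IsStrictBand (n r : ℕ) (p q : ℕ → ℕ) : Prop extends IsBand n r p q where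
  two_le : 2 ≤ n
  lt : ∀ k, 0 < k → k < n → p k < q k

/-- There are no loops, so inclusions between neighbourhoods can be tested on endpoints. This is
false for `n = 1`, `r = 0`, hence the field `two_le`. -/
theorem IsStrictBand.lt_of_mem (hB : IsStrictBand n r p q) {y : ℕ} (hy : y ∈ Icc 1 n) :
    p (y - 1) < q y := by
  have h2 := hB.two_le
  obtain ⟨h3, h4⟩ := hy
  rcases Nat.lt_or_ge 1 y with h | h
  · have := hB.lt (y - 1) (by omega) (by omega)
    have := hB.q_mono (Nat.sub_le y 1)
    omega
  · obtain rfl : y = 1 := by omega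
    have h5 := hB.lt 1 (by omega) (by omega)
    have h6 := hB.p_zero
    simp only [Nat.sub_self]
    omega

/-- The position, the size and the closure of a circuit. -/
theorem IsStrictBand.exists_of_isCircuit (hB : IsStrictBand n r p q) {D : Finset ℕ}
    (hD : (bandMatroid n p q).IsCircuit D) :
    ∃ a ∈ D, ∃ b ∈ D, (∀ x ∈ D, a ≤ x ∧ x ≤ b) ∧ p (a - 1) + D.card = q b + 1 ∧
      (bandMatroid n p q).closure D = {y | y ∈ Icc 1 n ∧ p (a - 1) ≤ p (y - 1) ∧ q y ≤ q b} := by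
  have hne : D.Nonempty := by exact_mod_cast hD.nonempty
  have hab : ∀ x ∈ D, D.min' hne ≤ x ∧ x ≤ D.max' hne :=
    fun x hx => ⟨D.min'_le x hx, D.le_max' x hx⟩
  have hN := hB.nbhds_eq_Ioc hD (D.min'_mem hne) (D.max'_mem hne) hab
  refine ⟨_, D.min'_mem hne, _, D.max'_mem hne, hab, ?_, ?_⟩
  · have h1 := card_nbhds_add_one hD
    rw [hN, Nat.card_Ioc] at h1
    have h2 := hB.p_mono (Nat.sub_le (D.min' hne) 1)
    have h3 := hB.le (D.min' hne)
    have h4 := hB.q_mono (hab _ (D.max'_mem hne)).1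
    omega
  · ext y
    rw [mem_closure_isCircuit_iff hD, hN]
    refine and_congr_right fun hy => ?_
    rw [nbhd, ← Finset.coe_subset, Finset.coe_Ioc, Finset.coe_Ioc,
      Ioc_subset_Ioc_iff (hB.lt_of_mem hy), and_comm]

theorem IsStrictBand.eRk_closure_isCircuit {D : Finset ℕ}
    (hD : (bandMatroid n p q).IsCircuit D) {s : ℕ} (h : D.card = s + 1) :
    (bandMatroid n p q).eRk ((bandMatroid n p q).closure D) = s := by
  have h1 := hD.eRk_add_one_eq
  rw [encard_coe_eq_coe_finsetCard, h, Nat.cast_add, Nat.cast_one] at h1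
  rw [Matroid.eRk_closure_eq]
  exact ENat.add_left_injective_of_ne_top ENat.one_ne_top h1

/-- If the matroid is connected, then the two paths meet only at their endpoints. -/
theorem IsBand.lt_of_isConnected (hB : IsBand n r p q) (hc : IsConnected (bandMatroid n p q))
    {k : ℕ} (h0 : 0 < k) (hk : k < n) : p k < q k := by
  classical
  by_contra hcon
  obtain ⟨C, hC, h1, h2⟩ := hc k (by rw [bandMatroid_ground]; exact ⟨h0, hk.le⟩) (k + 1)
    (by rw [bandMatroid_ground]; exact ⟨by omega, hk⟩) (by omega)
  obtain ⟨D, rfl⟩ := exists_finset_eq_of_subset_ground hC.subset_ground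
  rw [Finset.mem_coe] at h1 h2
  -- Where the paths touch, elements up to `k` see only indices up to `q k`, and later elements only
  -- indices above `p k ≥ q k`.
  refine not_disjoint_nbhds_of_isCircuit hC (D₁ := {d ∈ D | d ≤ k})
    (D₂ := {d ∈ D | k + 1 ≤ d}) ?_ ?_ ?_ ?_
  · exact Finset.filter_ssubset.2 ⟨k + 1, h2, by omega⟩
  · exact Finset.filter_ssubset.2 ⟨k, h1, by omega⟩
  · intro d hd
    simp only [Finset.mem_union, Finset.mem_filter, hd, true_and]
    omega
  · refine Finset.disjoint_left.2 fun i h1 h2 => ?_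
    obtain ⟨x, hx, hx1, hx2⟩ := mem_nbhds.1 h1
    obtain ⟨y, hy, hy1, hy2⟩ := mem_nbhds.1 h2
    rw [Finset.mem_filter] at hx hy
    have := hB.q_mono hx.2
    have := hB.p_mono (show k ≤ y - 1 by omega)
    omega

end Circuits

/-! ### Fundamental flats -/

/-- A proper subset `F` of the ground set that is spanned by a circuit, and also by its
intersection with some spanning circuit. -/
def IsFundamentalFlat {α : Type*} (M : Matroid α) (F : Set α) : Prop :=
  F ≠ M.E ∧ (∃ D, M.IsCircuit D ∧ M.closure D = F) ∧
    ∃ C, M.IsCircuit C ∧ M.closure C = M.E ∧ M.closure (C ∩ F) = F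

section Fundamental

variable {n r : ℕ} {p q : ℕ → ℕ}

theorem IsStrictBand.eq_of_isFundamentalFlat (hB : IsStrictBand n r p q) {F : Set ℕ}
    (hF : IsFundamentalFlat (bandMatroid n p q) F) :
    (∃ b, 0 < b ∧ b < n ∧ F = Icc 1 b ∧ (bandMatroid n p q).eRk F = q b) ∨
      (∃ a, 0 < a ∧ a < n ∧ F = Ioc a n ∧ (bandMatroid n p q).eRk F + p a = r) := by
  classical
  obtain ⟨hFE, ⟨D, hD, hDF⟩, C, hC, hCE, hCF⟩ := hF
  obtain ⟨D, rfl⟩ := exists_finset_eq_of_subset_ground hD.subset_ground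
  obtain ⟨C, rfl⟩ := exists_finset_eq_of_subset_ground hC.subset_ground
  obtain ⟨a, haD, b, hbD, hab, hcard, hcl⟩ := hB.exists_of_isCircuit hD
  obtain ⟨a', haC, b', hbC, hab', hcard', hcl'⟩ := hB.exists_of_isCircuit hC
  have hDE : (D : Set ℕ) ⊆ Icc 1 n := by simpa using hD.subset_ground
  have hCsub : (C : Set ℕ) ⊆ Icc 1 n := by simpa using hC.subset_ground
  have hn := hB.two_le
  have hab1 := hab a haD
  have hpq : p (a - 1) < q b := by
    have := hB.lt_of_mem (hDE haD)
    have := hB.q_mono (hab a haD).2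
    omega
  obtain ⟨s, hs⟩ := Nat.exists_eq_add_of_lt hpq
  have hrk := IsStrictBand.eRk_closure_isCircuit hD (s := s + 1) (by omega)
  rw [hDF] at hrk
  have hFmem : ∀ y, y ∈ F ↔ y ∈ Icc 1 n ∧ p (a - 1) ≤ p (y - 1) ∧ q y ≤ q b := by
    intro y; rw [← hDF, hcl]; rfl
  -- the spanning circuit meets every set of the presentation
  have hEC : ∀ y ∈ Icc 1 n, p (a' - 1) ≤ p (y - 1) ∧ q y ≤ q b' := by
    intro y hy
    have : y ∈ (bandMatroid n p q).closure C := by rw [hCE]; simpa using hy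
    rw [hcl'] at this
    exact this.2
  have ha'0 : p (a' - 1) = 0 := by
    have := (hEC 1 ⟨le_rfl, by omega⟩).1
    have h0 := hB.p_zero
    simp only [Nat.sub_self] at this
    omega
  have hb'r : q b' = r := by
    have h1 := (hEC n ⟨by omega, le_rfl⟩).2
    have h2 := hB.q_eq n le_rfl
    have h3 := hB.q_mono (hCsub hbC).2
    omega
  have hnsub : ¬ (C : Set ℕ) ⊆ F := by
    intro h
    rw [inter_eq_self_of_subset_left h, hCE] at hCF
    exact hFE hCF.symm
  set X : Finset ℕ := {c ∈ C | c ∈ F} with hX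
  have hXcoe : (X : Set ℕ) = (C : Set ℕ) ∩ F := by ext; simp [hX]
  have hXind : (bandMatroid n p q).Indep X := by
    rw [hXcoe]
    exact hC.ssubset_indep ⟨inter_subset_left, fun h => hnsub (h.trans inter_subset_right)⟩
  have hXcard : X.card = s + 1 := by
    have h1 := hXind.eRk_eq_encard
    rw [← Matroid.eRk_closure_eq, hXcoe, hCF, hrk, ← hXcoe, encard_coe_eq_coe_finsetCard] at h1
    exact_mod_cast h1.symm
  -- Membership in `F` is a lower and an upper condition. Each element of `C` satisfies at least one
  -- of them, since it lies on one side of `a ≤ b`.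
  set Z₀ : Finset ℕ := {c ∈ C | p (a - 1) ≤ p (c - 1)} with hZ₀
  set Z₁ : Finset ℕ := {c ∈ C | q c ≤ q b} with hZ₁
  have hXE : X = Z₀ ∩ Z₁ := by
    ext c
    simp only [hX, hZ₀, hZ₁, Finset.mem_filter, Finset.mem_inter, hFmem]
    constructor
    · tauto
    · rintro ⟨⟨h1, h2⟩, h3, h4⟩
      exact ⟨h1, hCsub h1, h2, h4⟩
  have hCE' : C = Z₀ ∪ Z₁ := by
    ext c
    simp only [hZ₀, hZ₁, Finset.mem_filter, Finset.mem_union]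
    constructor
    · intro hc
      rcases le_total a c with h | h
      · exact Or.inl ⟨hc, hB.p_mono (by omega)⟩
      · exact Or.inr ⟨hc, hB.q_mono (by omega)⟩
    · tauto
  have hsum := Finset.card_union_add_card_inter Z₀ Z₁
  rw [← hXE, ← hCE'] at hsum
  have hbn : b ∈ Icc 1 n := hDE hbD
  have han : a ∈ Icc 1 n := hDE haD
  -- Otherwise both parts are independent, of sizes at most `r - p (a - 1)` and `q b`. But their
  -- sizes add up to `C.card + X.card = (r + 1) + (q b - p (a - 1))`.
  obtain hZ | hZ : Z₀ = C ∨ Z₁ = C := by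
    by_contra! hcon
    have i0 : (bandMatroid n p q).Indep Z₀ := hC.ssubset_indep
      (Finset.coe_ssubset.2 ((Finset.filter_subset _ _).ssubset_of_ne hcon.1))
    have i1 : (bandMatroid n p q).Indep Z₁ := hC.ssubset_indep
      (Finset.coe_ssubset.2 ((Finset.filter_subset _ _).ssubset_of_ne hcon.2))
    have c0 : Z₀.card ≤ r - p (a - 1) := by
      rw [← Nat.card_Ioc]
      refine (card_le_card_nbhds i0).trans (Finset.card_le_card fun i hi => ?_)
      obtain ⟨x, hx, hx1, hx2⟩ := mem_nbhds.1 hi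
      rw [hZ₀, Finset.mem_filter] at hx
      have := hab' x hx.1
      have := hB.q_mono this.2
      rw [Finset.mem_Ioc]; omega
    have c1 : Z₁.card ≤ q b := by
      rw [← Nat.sub_zero (q b), ← Nat.card_Ioc]
      refine (card_le_card_nbhds i1).trans (Finset.card_le_card fun i hi => ?_)
      obtain ⟨x, hx, hx1, hx2⟩ := mem_nbhds.1 hi
      rw [hZ₁, Finset.mem_filter] at hx
      rw [Finset.mem_Ioc]; omega
    have : q b ≤ r := by
      rw [← hB.q_eq n le_rfl]; exact hB.q_mono hbn.2
    omega
  · left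
    have hp0 : p (a - 1) = 0 := by
      have : a' ∈ Z₀ := hZ ▸ haC
      rw [hZ₀, Finset.mem_filter] at this
      omega
    -- The circuit may end inside a run of East steps of the upper path; the flat extends to the end
    -- `m` of that run.
    have hP : q (Nat.findGreatest (fun k => q k ≤ q b) n) ≤ q b :=
      Nat.findGreatest_spec (P := fun k => q k ≤ q b) hbn.2 le_rfl
    set m := Nat.findGreatest (fun k => q k ≤ q b) n with hm
    have hbm : b ≤ m := Nat.le_findGreatest hbn.2 le_rfl
    have hmn : m ≤ n := Nat.findGreatest_le n
    have hFeq : F = Icc 1 m := by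
      ext y
      rw [hFmem, hp0, mem_Icc, mem_Icc]
      constructor
      · rintro ⟨⟨h1, h2⟩, -, h3⟩
        exact ⟨h1, Nat.le_findGreatest h2 h3⟩
      · rintro ⟨h1, h2⟩
        exact ⟨⟨h1, by omega⟩, Nat.zero_le _, (hB.q_mono h2).trans hP⟩
    refine ⟨m, by have := hbn.1; omega, hmn.lt_of_ne fun h => hFE ?_, hFeq, ?_⟩
    · rw [hFeq, h, bandMatroid_ground]
    · rw [hrk]
      have := hB.q_mono hbm
      exact_mod_cast (by omega : s + 1 = q m)
  · right
    have hqr : q b = r := by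
      have h1 : b' ∈ Z₁ := hZ ▸ hbC
      rw [hZ₁, Finset.mem_filter] at h1
      have h2 : q b ≤ r := by
        rw [← hB.q_eq n le_rfl]; exact hB.q_mono hbn.2
      omega
    -- Likewise the flat starts just after the first point where `p` reaches the height `p (a - 1)`.
    have hex : ∃ k, p (a - 1) ≤ p k := ⟨a - 1, le_rfl⟩
    have hP := Nat.find_spec hex
    set m := Nat.find hex with hm
    have hma : m ≤ a - 1 := Nat.find_min' hex le_rfl
    have hFeq : F = Ioc m n := by
      ext y
      rw [hFmem, hqr, mem_Icc, mem_Ioc]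
      constructor
      · rintro ⟨⟨h1, h2⟩, h3, -⟩
        have := Nat.find_min' hex h3
        exact ⟨by omega, h2⟩
      · rintro ⟨h1, h2⟩
        refine ⟨⟨by omega, h2⟩, hP.trans (hB.p_mono (by omega)), ?_⟩
        rw [← hB.q_eq n le_rfl]; exact hB.q_mono h2
    have ha1 := han.1
    have ha2 := han.2
    refine ⟨m, Nat.pos_of_ne_zero fun h => hFE ?_, by omega, hFeq, ?_⟩
    · rw [hFeq, h, bandMatroid_ground]; rfl
    · rw [hrk]
      have := hB.p_mono hma
      exact_mod_cast (by omega : s + 1 + p m = r)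

end Fundamental


/-! ### Corners of the upper path give fundamental flats -/

section Corners

variable {n r : ℕ} {p q : ℕ → ℕ}

/-- The positions among the first `e` steps at which the height `q` increases. -/
def northPositions (q : ℕ → ℕ) (e : ℕ) : Finset ℕ := {k ∈ Finset.Icc 1 e | q (k - 1) < q k}

theorem mem_northPositions {q : ℕ → ℕ} {e k : ℕ} :
    k ∈ northPositions q e ↔ (1 ≤ k ∧ k ≤ e) ∧ q (k - 1) < q k := by
  simp [northPositions]

theorem IsBand.card_northPositions (hB : IsBand n r p q) (e : ℕ) :
    (northPositions q e).card = q e := by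
  induction e with
  | zero => simp [northPositions, hB.q_zero]
  | succ e ih =>
    have h1 := hB.q_mono (Nat.le_succ e)
    have h2 := hB.q_succ_le e
    rw [northPositions, ← Finset.insert_Icc_right_eq_Icc_add_one (by omega), Finset.filter_insert]
    rw [northPositions] at ih
    simp only [Nat.add_sub_cancel, Nat.succ_eq_add_one] at h1 ⊢
    split_ifs with h
    · rw [Finset.card_insert_of_notMem (by simp), ih]; omega
    · rw [ih]; omega

theorem IsBand.northPositions_indep (hB : IsBand n r p q) :
    (bandMatroid n p q).Indep (northPositions q n) := by
  rw [bandMatroid_indep_iff]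
  refine ⟨fun x hx => (mem_northPositions.1 hx).1, q, ?_, fun x hx => mem_nbhd.2 ⟨?_, le_rfl⟩⟩
  · refine StrictMonoOn.injOn fun x hx y hy hxy => ?_
    exact (hB.q_mono (Nat.le_sub_one_of_lt hxy)).trans_lt (mem_northPositions.1 hy).2
  · exact (hB.le _).trans_lt (mem_northPositions.1 hx).2

theorem IsBand.card_le_of_indep (hB : IsBand n r p q) {I : Finset ℕ}
    (hI : (bandMatroid n p q).Indep I) {e : ℕ} (h : ∀ x ∈ I, x ≤ e) : I.card ≤ q e := by
  rw [← Nat.sub_zero (q e), ← Nat.card_Ioc]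
  refine (card_le_card_nbhds hI).trans (Finset.card_le_card fun i hi => ?_)
  obtain ⟨x, hx, hx1, hx2⟩ := mem_nbhds.1 hi
  have := hB.q_mono (h x hx)
  rw [Finset.mem_Ioc]; omega

theorem IsBand.eRank_eq (hB : IsBand n r p q) : (bandMatroid n p q).eRank = r := by
  have hcard := hB.card_northPositions n
  rw [hB.q_eq n le_rfl] at hcard
  refine le_antisymm ?_ ?_
  · obtain ⟨I, hI⟩ := (bandMatroid n p q).exists_isBase
    obtain ⟨I, rfl⟩ := exists_finset_eq_of_subset_ground hI.subset_ground
    rw [← hI.encard_eq_eRank, encard_coe_eq_coe_finsetCard, ← hB.q_eq n le_rfl]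
    have h := hI.subset_ground
    rw [bandMatroid_ground] at h
    exact_mod_cast hB.card_le_of_indep hI.indep fun x hx => (h hx).2
  · rw [← hcard, ← encard_coe_eq_coe_finsetCard]
    exact hB.northPositions_indep.encard_le_eRank

/-- The `q e + 1` elements see only `q e` indices. After deleting `c`, elements before `c` keep the
index `q k` and later ones move down to `q (k - 1)`, which is allowed because `p (k - 1) < q (k -
1)`. -/
theorem IsStrictBand.isCircuit_insert_northPositions (hB : IsStrictBand n r p q) {e : ℕ}
    (h2 : 2 ≤ e) (hen : e ≤ n) (he : q (e - 1) = q e) :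
    (bandMatroid n p q).IsCircuit (insert e (northPositions q e) : Finset ℕ) := by
  have heN : e ∉ northPositions q e := fun h => (mem_northPositions.1 h).2.ne he
  have hsub : ((insert e (northPositions q e) : Finset ℕ) : Set ℕ) ⊆ Icc 1 n := by
    intro k hk
    rcases Finset.mem_insert.1 (Finset.mem_coe.1 hk) with rfl | hk
    · exact ⟨by omega, hen⟩
    · have := (mem_northPositions.1 hk).1
      exact ⟨this.1, by omega⟩
  have hle : ∀ x ∈ insert e (northPositions q e), x ≤ e := by
    intro k hk
    rcases Finset.mem_insert.1 hk with rfl | hk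
    · exact le_rfl
    · exact (mem_northPositions.1 hk).1.2
  rw [Matroid.isCircuit_iff_dep_forall_sdiff_singleton_indep]
  refine ⟨⟨fun h => ?_, by simpa using hsub⟩, fun c hc => ?_⟩
  · have := hB.card_le_of_indep h hle
    rw [Finset.card_insert_of_notMem heN, hB.card_northPositions] at this
    omega
  rw [bandMatroid_indep_iff]
  refine ⟨sdiff_subset.trans hsub, fun k => if k < c then q k else q (k - 1), ?_, ?_⟩
  · have hlt : ∀ x ∈ insert e (northPositions q e), x ≠ e → q (x - 1) < q x := by
      intro x hx hxe
      exact (mem_northPositions.1 ((Finset.mem_insert.1 hx).resolve_left hxe)).2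
    refine StrictMonoOn.injOn fun x hx y hy hxy => ?_
    have hxD : x ∈ insert e (northPositions q e) := hx.1
    have hyD : y ∈ insert e (northPositions q e) := hy.1
    have hxc : x ≠ c := hx.2
    have hyc : y ≠ c := hy.2
    have hce := hle c hc
    have hye := hle y hyD
    have hxlt := hlt x hxD (by omega)
    have hxy' := hB.q_mono (show x ≤ y - 1 by omega)
    split_ifs with h3 h4 h4
    · exact hxy'.trans_lt (hlt y hyD (by omega))
    · have hclt := hlt c hc (by omega)
      have := hB.q_mono (show x ≤ c - 1 by omega)
      have := hB.q_mono (show c ≤ y - 1 by omega)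
      omega
    · omega
    · omega
  · rintro x ⟨hx, hxc⟩
    have hxE := hsub hx
    have hxe := hle x hx
    have hc1 := (hsub hc).1
    have hxc' : x ≠ c := hxc
    rw [mem_nbhd]
    dsimp only
    split_ifs with h3
    · exact ⟨hB.lt_of_mem hxE, le_rfl⟩
    · exact ⟨hB.lt (x - 1) (by omega) (by omega), hB.q_mono (Nat.sub_le x 1)⟩

theorem IsStrictBand.closure_insert_northPositions (hB : IsStrictBand n r p q) {e : ℕ}
    (h2 : 2 ≤ e) (hen : e ≤ n) (he : q (e - 1) = q e) :
    (bandMatroid n p q).closure (insert e (northPositions q e) : Finset ℕ) =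
      {y | y ∈ Icc 1 n ∧ q y ≤ q e} := by
  obtain ⟨a, ha, b, hb, hab, -, hcl⟩ :=
    hB.exists_of_isCircuit (hB.isCircuit_insert_northPositions h2 hen he)
  have h1 : 1 ∈ insert e (northPositions q e) := by
    refine Finset.mem_insert_of_mem (mem_northPositions.2 ⟨⟨le_rfl, by omega⟩, ?_⟩)
    have := hB.lt 1 (by omega) (by omega)
    have := hB.q_zero
    simp only [Nat.sub_self]
    omega
  have ha1 : a - 1 = 0 := by have := (hab 1 h1).1; omega
  have hbe : b = e := by
    have := (hab e (Finset.mem_insert_self _ _)).2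
    rcases Finset.mem_insert.1 hb with h | h
    · exact h
    · have := (mem_northPositions.1 h).1; omega
  rw [hcl, ha1, hbe, hB.p_zero]
  simp

/-- An east step of the upper path followed by a north step gives a fundamental flat. -/
theorem IsStrictBand.isFundamentalFlat_Icc (hB : IsStrictBand n r p q) {b : ℕ} (hb0 : 0 < b)
    (hbn : b < n) (h1 : q (b - 1) = q b) (h2 : q (b + 1) = q b + 1) :
    IsFundamentalFlat (bandMatroid n p q) (Icc 1 b) := by
  have hb2 : 2 ≤ b := by
    by_contra hcon
    obtain rfl : b = 1 := by omega
    have := hB.lt 1 (by omega) hbn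
    have := hB.q_zero
    simp only [Nat.sub_self] at h1
    omega
  -- The last step of the upper path is East, since `r ≤ p (n - 1) + 1 ≤ q (n - 1)`. This provides
  -- the spanning circuit.
  have hn : q (n - 1) = q n := by
    obtain ⟨k, rfl⟩ : ∃ k, n = k + 1 := ⟨n - 1, by omega⟩
    have := hB.lt k (by omega) (by omega)
    have := hB.p_succ_le k
    have := hB.q_mono (Nat.le_succ k)
    rw [hB.p_eq _ le_rfl] at *
    rw [Nat.succ_eq_add_one, hB.q_eq _ le_rfl] at *
    rw [Nat.add_sub_cancel]
    omega
  have hcl : (bandMatroid n p q).closure (insert b (northPositions q b) : Finset ℕ) = Icc 1 b := by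
    rw [hB.closure_insert_northPositions hb2 hbn.le h1]
    ext y
    simp only [mem_ofPred_eq, mem_Icc]
    constructor
    · rintro ⟨⟨h3, h4⟩, h5⟩
      refine ⟨h3, ?_⟩
      by_contra hcon
      have := hB.q_mono (show b + 1 ≤ y by omega)
      omega
    · rintro ⟨h3, h4⟩
      exact ⟨⟨h3, by omega⟩, hB.q_mono h4⟩
  refine ⟨fun h => ?_, ⟨_, hB.isCircuit_insert_northPositions hb2 hbn.le h1, hcl⟩, _,
    hB.isCircuit_insert_northPositions hB.two_le le_rfl hn, ?_, ?_⟩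
  · rw [bandMatroid_ground] at h
    have : n ∈ Icc 1 b := h ▸ ⟨by omega, le_rfl⟩
    exact hbn.not_ge this.2
  · rw [hB.closure_insert_northPositions hB.two_le le_rfl hn, bandMatroid_ground]
    ext y
    simp only [mem_ofPred_eq, and_iff_left_iff_imp]
    exact fun hy => hB.q_mono hy.2
  -- The spanning circuit meets the interval in the smaller circuit without `b`, and deleting one
  -- element of a circuit does not change its closure.
  · have : ((insert n (northPositions q n) : Finset ℕ) : Set ℕ) ∩ Icc 1 b =
        ((insert b (northPositions q b) : Finset ℕ) : Set ℕ) \ {b} := by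
      ext y
      simp only [mem_inter_iff, mem_sdiff, Finset.mem_coe, Finset.mem_insert,
        mem_northPositions, mem_Icc, mem_singleton_iff]
      constructor
      · rintro ⟨h3 | h3, h4, h5⟩
        · omega
        · refine ⟨Or.inr ⟨⟨h4, h5⟩, h3.2⟩, ?_⟩
          rintro rfl
          omega
      · rintro ⟨h3, h4⟩
        have h5 := h3.resolve_left h4
        exact ⟨Or.inr ⟨⟨h5.1.1, by omega⟩, h5.2⟩, h5.1⟩
    rw [this, (hB.isCircuit_insert_northPositions hb2 hbn.le h1).closure_sdiff_singleton_eq, hcl]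

theorem IsStrictBand.eRk_Icc (hB : IsStrictBand n r p q) {b : ℕ} (hb0 : 0 < b)
    (h : IsFundamentalFlat (bandMatroid n p q) (Icc 1 b)) :
    (bandMatroid n p q).eRk (Icc 1 b) = q b := by
  have h1 : 1 ∈ Icc 1 b := ⟨le_rfl, hb0⟩
  rcases hB.eq_of_isFundamentalFlat h with ⟨c, -, -, hc, hr⟩ | ⟨a, ha, -, hc, -⟩
  · have := congrArg ncard hc
    rw [ncard_Icc_nat, ncard_Icc_nat] at this
    rw [hr, show b = c by omega]
  · rw [hc] at h1
    have := h1.1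
    omega

theorem IsStrictBand.eRk_Ioc (hB : IsStrictBand n r p q) {a : ℕ} (ha0 : 0 < a) (han : a < n)
    (h : IsFundamentalFlat (bandMatroid n p q) (Ioc a n)) :
    (bandMatroid n p q).eRk (Ioc a n) + p a = r := by
  rcases hB.eq_of_isFundamentalFlat h with ⟨c, hc0, -, hc, -⟩ | ⟨a', -, ha', hc, hr⟩
  · have h1 : 1 ∈ Icc 1 c := ⟨le_rfl, hc0⟩
    rw [← hc] at h1
    have := h1.1
    omega
  · have := congrArg ncard hc
    rw [ncard_Ioc_nat, ncard_Ioc_nat] at this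
    rw [show a = a' by omega]
    rwa [show a = a' by omega] at hr

/-- A path that goes through all east-north corners of a path with height `q`, and has the same
endpoint, stays below it. -/
theorem le_of_eq_at_corners {q q' : ℕ → ℕ} (hq : Monotone q) (hq' : Monotone q')
    (hs : ∀ k, q (k + 1) ≤ q k + 1) (hs' : ∀ k, q' (k + 1) ≤ q' k + 1)
    (h0 : q' 0 ≤ q 0) (hn : q' n ≤ q n)
    (h : ∀ b, 0 < b → b < n → q (b - 1) = q b → q (b + 1) = q b + 1 → q' b = q b) :
    ∀ k ≤ n, q' k ≤ q k := by
  intro k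
  induction k with
  | zero => exact fun _ => h0
  | succ k ih =>
    intro hk
    by_contra! hcon
    have h1 := ih (by omega)
    have h2 := hs' k
    have h3 := hq (Nat.le_succ k)
    rw [Nat.succ_eq_add_one] at h3
    -- If `q'` first exceeds `q` at `k + 1`, that step is East for `q`. The end `b` of this East run
    -- is a corner or `n`, and `q' b` still exceeds `q b` there.
    have hP : q (Nat.findGreatest (fun j => q j ≤ q (k + 1)) n) ≤ q (k + 1) :=
      Nat.findGreatest_spec (P := fun j => q j ≤ q (k + 1)) hk le_rfl
    have hbm : k + 1 ≤ Nat.findGreatest (fun j => q j ≤ q (k + 1)) n :=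
      Nat.le_findGreatest hk le_rfl
    have hmn := Nat.findGreatest_le (P := fun j => q j ≤ q (k + 1)) n
    have hgt : ∀ j, Nat.findGreatest (fun j => q j ≤ q (k + 1)) n < j → j ≤ n →
      ¬ q j ≤ q (k + 1) := fun j hj hjn => 
        Nat.findGreatest_is_greatest (P := fun j => q j ≤ q (k + 1)) hj hjn
    generalize Nat.findGreatest (fun j => q j ≤ q (k + 1)) n = b at *
    have h4 := hq hbm
    have h5 := hq' hbm
    rcases hmn.eq_or_lt with rfl | hbn
    · omega
    · have h6 := hgt (b + 1) (by omega) (by omega)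
      have h7 := hs b
      have h8 := hq (show k ≤ b - 1 by omega)
      have h9 := hq (Nat.sub_le b 1)
      have := h b (by omega) hbn (by omega) (by omega)
      omega

end Corners

/-! ### Isomorphisms -/

section Isomorphisms

variable {α β : Type*} {M : Matroid α} {f : α → β}

theorem isIsomorphic_refl (M : Matroid α) : IsIsomorphic M M :=
  ⟨Equiv.refl _, fun _ => Iff.rfl⟩

theorem IsIsomorphic.symm {N : Matroid β} (h : IsIsomorphic M N) : IsIsomorphic N M := by
  obtain ⟨e, he⟩ := h
  refine ⟨e.symm, fun I => ?_⟩
  have := he (e.symm '' I)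
  rw [image_image, image_image] at this
  simpa using this.symm

/-- Replaces the bijection of ground sets by `Matroid.map`, through which circuits, closures and
ranks are transported. The values of `f` off the ground set are arbitrary. -/
theorem IsIsomorphic.exists_eq_map [Nonempty β] {N : Matroid β} (h : IsIsomorphic M N) :
    ∃ (f : α → β) (hf : InjOn f M.E), N = M.map f hf := by
  classical
  obtain ⟨e, he⟩ := h
  let f : α → β := fun x => if hx : x ∈ M.E then e ⟨x, hx⟩ else Classical.arbitrary β
  have hfe : ∀ x : M.E, f x = e x := fun x => by simp [f]
  have hf : InjOn f M.E := fun x hx y hy hxy => by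
    have := hfe ⟨x, hx⟩ ▸ hfe ⟨y, hy⟩ ▸ hxy
    exact congrArg Subtype.val (e.injective (Subtype.ext this))
  have hfI : ∀ I : Set M.E,
      f '' ((fun x : M.E => (x : α)) '' I) = (fun x : M.E => (e x : β)) '' I := fun I => by
    rw [image_image]
    exact image_congr fun x _ => hfe x
  refine ⟨f, hf, Matroid.ext_indep ?_ fun J hJ => ?_⟩
  · rw [Matroid.map_ground]
    ext y
    constructor
    · intro hy
      exact ⟨e.symm ⟨y, hy⟩, (e.symm ⟨y, hy⟩).2, by rw [hfe]; simp⟩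
    · rintro ⟨x, hx, rfl⟩
      rw [hfe ⟨x, hx⟩]
      exact (e ⟨x, hx⟩).2
  · rw [Matroid.map_indep_iff]
    constructor
    · intro hJi
      have hJe : (fun x : M.E => (e x : β)) '' {x | (e x : β) ∈ J} = J := by
        ext y
        constructor
        · rintro ⟨x, hx, rfl⟩; exact hx
        · intro hy
          exact ⟨e.symm ⟨y, hJ hy⟩, by simpa using hy, by simp⟩
      refine ⟨_, (he {x | (e x : β) ∈ J}).2 (hJe.symm ▸ hJi), ?_⟩
      rw [hfI, hJe]
    · rintro ⟨I, hI, rfl⟩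
      have hIe : (fun x : M.E => (x : α)) '' {x | (x : α) ∈ I} = I := by
        ext y
        constructor
        · rintro ⟨x, hx, rfl⟩; exact hx
        · intro hy; exact ⟨⟨y, hI.subset_ground hy⟩, hy, rfl⟩
      rw [← hIe, hfI]
      exact (he _).1 (hIe.symm ▸ hI)

theorem isIsomorphic_map (M : Matroid α) (f : α → β) (hf : InjOn f M.E) :
    IsIsomorphic M (M.map f hf) := by
  refine ⟨hf.bijOn_image.equiv, fun I => ?_⟩
  rw [← Matroid.map_image_indep_iff (hf := hf) (by rintro _ ⟨x, -, rfl⟩; exact x.2), image_image]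
  rfl

theorem isCircuit_map {hf : InjOn f M.E} {C : Set α} (hC : M.IsCircuit C) :
    (M.map f hf).IsCircuit (f '' C) := by
  rw [Matroid.isCircuit_iff_dep_forall_sdiff_singleton_indep]
  refine ⟨Matroid.map_dep_iff.2 ⟨C, hC.dep, rfl⟩, ?_⟩
  rintro _ ⟨c, hc, rfl⟩
  rw [← image_singleton, ← (hf.mono hC.subset_ground).image_sdiff_subset
    (singleton_subset_iff.2 hc)]
  exact (hC.sdiff_singleton_indep hc).map f hf

theorem closure_map_image {hf : InjOn f M.E} {X : Set α} (hX : X ⊆ M.E) :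
    (M.map f hf).closure (f '' X) = f '' M.closure X := by
  rw [Matroid.map_closure_eq, ← Matroid.closure_inter_ground, hf.preimage_image_inter hX]

theorem IsFundamentalFlat.subset_ground {F : Set α} (h : IsFundamentalFlat M F) : F ⊆ M.E := by
  obtain ⟨-, ⟨D, -, rfl⟩, -⟩ := h
  exact M.closure_subset_ground D

theorem IsFundamentalFlat.map (hf : InjOn f M.E) {F : Set α} (h : IsFundamentalFlat M F) :
    IsFundamentalFlat (M.map f hf) (f '' F) := by
  have hFE := h.subset_ground
  obtain ⟨hne, ⟨D, hD, hDF⟩, C, hC, hCE, hCF⟩ := h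
  refine ⟨fun hF => hne ?_, ⟨_, isCircuit_map hD, ?_⟩, _, isCircuit_map hC, ?_, ?_⟩
  · exact (hf.image_eq_image_iff hFE subset_rfl).1 hF
  · rw [closure_map_image hD.subset_ground, hDF]
  · rw [closure_map_image hC.subset_ground, hCE, Matroid.map_ground]
  · rw [← hf.image_inter hC.subset_ground hFE,
      closure_map_image (inter_subset_left.trans hC.subset_ground), hCF]

theorem IsConnected.map (hf : InjOn f M.E) (h : IsConnected M) : IsConnected (M.map f hf) := by
  rintro _ ⟨x, hx, rfl⟩ _ ⟨y, hy, rfl⟩ hxy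
  obtain ⟨C, hC, hxC, hyC⟩ := h x hx y hy fun h => hxy (congrArg f h)
  exact ⟨_, isCircuit_map hC, mem_image_of_mem f hxC, mem_image_of_mem f hyC⟩

end Isomorphisms

/-! ### Rotation by a half turn -/

section Rotation

variable {n r : ℕ} {p q p' q' : ℕ → ℕ}

/-- The half turn sends step `j` to `n + 1 - j` and index `i` to `r + 1 - i`, so it carries
matchings to matchings. -/
theorem IsBand.indep_image_sub (hB : IsBand n r p q) (hp : ∀ k ≤ n, p' k + q (n - k) = r)
    (hq : ∀ k ≤ n, q' k + p (n - k) = r) {I : Set ℕ} (hI : (bandMatroid n p q).Indep I) :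
    (bandMatroid n p' q').Indep ((fun j => n + 1 - j) '' I) := by
  rw [bandMatroid_indep_iff] at hI ⊢
  obtain ⟨hIE, f, hf, hfA⟩ := hI
  have hsub : ∀ x ∈ I, n + 1 - (n + 1 - x) = x := by
    intro x hx
    have := (hIE hx).2
    omega
  have hfr : ∀ x ∈ I, f x ≤ r := by
    intro x hx
    rw [← hB.q_eq n le_rfl]
    exact (mem_nbhd.1 (hfA x hx)).2.trans (hB.q_mono (hIE hx).2)
  refine ⟨?_, fun y => r + 1 - f (n + 1 - y), ?_, ?_⟩
  · rintro _ ⟨x, hx, rfl⟩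
    obtain ⟨h1, h2⟩ := hIE hx
    exact ⟨by dsimp only; omega, by dsimp only; omega⟩
  · rintro _ ⟨x, hx, rfl⟩ _ ⟨y, hy, rfl⟩ hxy
    dsimp only at hxy ⊢
    rw [hsub x hx, hsub y hy] at hxy
    have h1 := hfr x hx
    have h2 := hfr y hy
    rw [hf hx hy (by omega)]
  · rintro _ ⟨x, hx, rfl⟩
    obtain ⟨h1, h2⟩ := hIE hx
    have h3 := mem_nbhd.1 (hfA x hx)
    have h4 := hp (n + 1 - x - 1) (by omega)
    have h5 := hq (n + 1 - x) (by omega)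
    have h6 := hfr x hx
    rw [show n - (n + 1 - x - 1) = x by omega] at h4
    rw [show n - (n + 1 - x) = x - 1 by omega] at h5
    rw [mem_nbhd]
    dsimp only
    rw [hsub x hx]
    omega

theorem injOn_sub (n : ℕ) : InjOn (fun j => n + 1 - j) (Icc 1 n) := by
  rintro x ⟨-, hx⟩ y ⟨-, hy⟩ hxy
  dsimp only at hxy
  omega

theorem IsBand.bandMatroid_eq_map (hB : IsBand n r p q) (hB' : IsBand n r p' q')
    (hp : ∀ k ≤ n, p' k + q (n - k) = r) (hq : ∀ k ≤ n, q' k + p (n - k) = r) :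
    bandMatroid n p' q' = (bandMatroid n p q).map (fun j => n + 1 - j)
      (by rw [bandMatroid_ground]; exact injOn_sub n) := by
  have himg : ∀ I ⊆ Icc 1 n, (fun j => n + 1 - j) '' ((fun j => n + 1 - j) '' I) = I := by
    intro I hI
    rw [image_image]
    refine (image_congr fun x hx => ?_).trans (image_id I)
    have := (hI hx).2
    dsimp only [id]
    omega
  refine Matroid.ext_indep ?_ fun I hI => ?_
  · rw [Matroid.map_ground, bandMatroid_ground, bandMatroid_ground]
    ext y
    constructor
    · rintro ⟨h1, h2⟩
      exact ⟨n + 1 - y, ⟨by omega, by omega⟩, by dsimp only; omega⟩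
    · rintro ⟨x, ⟨h1, h2⟩, rfl⟩
      exact ⟨by dsimp only; omega, by dsimp only; omega⟩
  · rw [bandMatroid_ground] at hI
    rw [Matroid.map_indep_iff]
    constructor
    · intro h
      refine ⟨_, hB'.indep_image_sub (p' := p) (q' := q) (fun k hk => ?_) (fun k hk => ?_) h,
        (himg I hI).symm⟩
      · have := hq (n - k) (by omega)
        rw [show n - (n - k) = k by omega] at this
        omega
      · have := hp (n - k) (by omega)
        rw [show n - (n - k) = k by omega] at this
        omega
    · rintro ⟨J, hJ, rfl⟩
      exact hB.indep_image_sub hp hq hJ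

end Rotation


/-! ### Comparison of two pairs of paths with isomorphic matroids -/

section Comparison

variable {P Q P' Q' : List Step}

theorem IsBoundingPair.length_eq (h : IsBoundingPair P Q) : Q.length = P.length :=
  (endpoint_eq_iff.1 h.1).1.symm

theorem IsBoundingPair.count_eq (h : IsBoundingPair P Q) :
    Q.count Step.north = P.count Step.north :=
  (endpoint_eq_iff.1 h.1).2.symm

theorem IsBoundingPair.reverse (h : IsBoundingPair P Q) :
    IsBoundingPair Q.reverse P.reverse := by
  refine ⟨by rw [endpoint_reverse, endpoint_reverse, h.1], neverAbove_iff.2 fun k => ?_⟩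
  have h1 := height_reverse_add P k
  have h2 := height_reverse_add Q k
  have h3 := neverAbove_iff.1 h.2 (P.length - k)
  rw [h.length_eq, h.count_eq] at h2
  omega

theorem IsBoundingPair.bandMatroid_reverse (h : IsBoundingPair P Q) :
    ∃ hf, bandMatroid P.length (height Q.reverse) (height P.reverse) =
      (bandMatroid P.length (height P) (height Q)).map (fun j => P.length + 1 - j) hf := by
  have hB' := h.reverse.isBand
  rw [List.length_reverse, List.count_reverse, h.length_eq, h.count_eq] at hB'
  refine ⟨_, h.isBand.bandMatroid_eq_map hB' (fun k _ => ?_) fun k _ => height_reverse_add P k⟩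
  rw [← h.length_eq, ← h.count_eq]
  exact height_reverse_add Q k

theorem IsBoundingPair.isIsomorphic_reverse (h : IsBoundingPair P Q) :
    IsIsomorphic (latticePathMatroid Q.reverse P.reverse) (latticePathMatroid P Q) := by
  obtain ⟨hf, h1⟩ := h.bandMatroid_reverse
  rw [latticePathMatroid_eq h, latticePathMatroid_eq h.reverse, List.length_reverse, h.length_eq,
    h1]
  exact (isIsomorphic_map _ _ hf).symm

theorem IsBoundingPair.isStrictBand_reverse (h : IsBoundingPair P Q)
    (hB : IsStrictBand P.length (P.count Step.north) (height P) (height Q)) :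
    IsStrictBand P.length (P.count Step.north) (height Q.reverse) (height P.reverse) := by
  have hB' := h.reverse.isBand
  rw [List.length_reverse, List.count_reverse, h.length_eq, h.count_eq] at hB'
  refine ⟨hB', hB.two_le, fun k h0 hk => ?_⟩
  have h1 := height_reverse_add P k
  have h2 := height_reverse_add Q k
  have h3 := hB.lt (P.length - k) (by omega) (by omega)
  rw [h.length_eq, h.count_eq] at h2
  omega

/-- A north step of the lower path followed by an east step gives a fundamental flat. -/
theorem IsBoundingPair.isFundamentalFlat_Ioc (h : IsBoundingPair P Q)
    (hB : IsStrictBand P.length (P.count Step.north) (height P) (height Q)) {b : ℕ} (hb0 : 0 < b)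
    (hbn : b < P.length) (h1 : height P.reverse (b - 1) = height P.reverse b)
    (h2 : height P.reverse (b + 1) = height P.reverse b + 1) :
    IsFundamentalFlat (bandMatroid P.length (height P) (height Q))
      (Ioc (P.length - b) P.length) := by
  -- In the rotated pair the lower path becomes the upper one. Rotating back, `j ↦ n + 1 - j` turns
  -- `Icc 1 b` into `Ioc (n - b) n`.
  have hF := (h.isStrictBand_reverse hB).isFundamentalFlat_Icc hb0 hbn h1 h2
  have hr := h.reverse
  obtain ⟨hf, he⟩ := hr.bandMatroid_reverse
  simp only [List.reverse_reverse, List.length_reverse, h.length_eq] at he hf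
  have := IsFundamentalFlat.map hf hF
  rw [he]
  convert this using 1
  ext y
  simp only [mem_Ioc, mem_image, mem_Icc]
  constructor
  · rintro ⟨h3, h4⟩
    exact ⟨P.length + 1 - y, ⟨by omega, by omega⟩, by omega⟩
  · rintro ⟨x, ⟨h3, h4⟩, rfl⟩
    omega

/-- The initial intervals that are proper and nonempty. -/
def IsInitial (n : ℕ) (F : Set ℕ) : Prop := ∃ b, 0 < b ∧ b < n ∧ F = Icc 1 b

/-- The final intervals that are proper and nonempty. -/
def IsFinal (n : ℕ) (F : Set ℕ) : Prop := ∃ a, 0 < a ∧ a < n ∧ F = Ioc a n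

theorem IsInitial.comparable {n : ℕ} {F G : Set ℕ} (hF : IsInitial n F) (hG : IsInitial n G) :
    F ⊆ G ∨ G ⊆ F := by
  obtain ⟨b, -, -, rfl⟩ := hF
  obtain ⟨c, -, -, rfl⟩ := hG
  exact (le_total b c).imp Icc_subset_Icc_right Icc_subset_Icc_right

theorem IsFinal.comparable {n : ℕ} {F G : Set ℕ} (hF : IsFinal n F) (hG : IsFinal n G) :
    F ⊆ G ∨ G ⊆ F := by
  obtain ⟨b, -, -, rfl⟩ := hF
  obtain ⟨c, -, -, rfl⟩ := hG
  exact (le_total c b).imp Ioc_subset_Ioc_left Ioc_subset_Ioc_left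

theorem IsInitial.not_comparable {n : ℕ} {F G : Set ℕ} (hF : IsInitial n F) (hG : IsFinal n G) :
    ¬ (F ⊆ G ∨ G ⊆ F) := by
  obtain ⟨b, hb0, hbn, rfl⟩ := hF
  obtain ⟨a, ha0, han, rfl⟩ := hG
  rintro (h | h)
  · have := (h ⟨le_rfl, hb0⟩ : 1 ∈ Ioc a n).1
    omega
  · have := (h ⟨han, le_rfl⟩ : n ∈ Icc 1 b).2
    omega

theorem IsStrictBand.isInitial_or_isFinal {n r : ℕ} {p q : ℕ → ℕ} (hB : IsStrictBand n r p q)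
    {F : Set ℕ} (hF : IsFundamentalFlat (bandMatroid n p q) F) : IsInitial n F ∨ IsFinal n F := by
  rcases hB.eq_of_isFundamentalFlat hF with ⟨b, h0, h1, h2, -⟩ | ⟨a, h0, h1, h2, -⟩
  · exact Or.inl ⟨b, h0, h1, h2⟩
  · exact Or.inr ⟨a, h0, h1, h2⟩

theorem isFinal_iff {n : ℕ} {F : Set ℕ} (h : IsInitial n F ∨ IsFinal n F) :
    IsFinal n F ↔ ¬ IsInitial n F :=
  ⟨fun h1 h2 => h2.not_comparable h1 (Or.inl subset_rfl), h.resolve_left⟩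

/-- Comparability under inclusion survives an isomorphism, so it recovers the partition into two
chains, though not which chain is the initial one. -/
theorem comparable_iff {n : ℕ} {F G : Set ℕ} (hF : IsInitial n F ∨ IsFinal n F)
    (hG : IsInitial n G ∨ IsFinal n G) :
    (F ⊆ G ∨ G ⊆ F) ↔ (IsInitial n F ↔ IsInitial n G) := by
  constructor
  · intro h
    refine ⟨fun h1 => hG.resolve_right fun h2 => h1.not_comparable h2 h,
      fun h1 => hF.resolve_right fun h2 => h1.not_comparable h2 h.symm⟩
  · intro h
    rcases hF with h1 | h1
    · exact h1.comparable (h.1 h1)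
    · refine h1.comparable (hG.resolve_left fun h2 => ?_)
      exact (h.2 h2).not_comparable h1 (Or.inl subset_rfl)

/-- An isomorphism either preserves or exchanges the two chains of fundamental flats. -/
theorem IsStrictBand.preserves_or_exchanges {n r r' : ℕ} {p q p' q' f : ℕ → ℕ}
    (hB : IsStrictBand n r p q) (hB' : IsStrictBand n r' p' q')
    (hf : InjOn f (bandMatroid n p q).E)
    (he : bandMatroid n p' q' = (bandMatroid n p q).map f hf) :
    (∀ F, IsFundamentalFlat (bandMatroid n p q) F →
      (IsInitial n F → IsInitial n (f '' F)) ∧ (IsFinal n F → IsFinal n (f '' F))) ∨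
    (∀ F, IsFundamentalFlat (bandMatroid n p q) F →
      (IsInitial n F → IsFinal n (f '' F)) ∧ (IsFinal n F → IsInitial n (f '' F))) := by
  have himg : ∀ F, IsFundamentalFlat (bandMatroid n p q) F →
      IsInitial n (f '' F) ∨ IsFinal n (f '' F) := fun F hF =>
    hB'.isInitial_or_isFinal (he ▸ hF.map hf)
  have hcomp : ∀ F G, IsFundamentalFlat (bandMatroid n p q) F →
      IsFundamentalFlat (bandMatroid n p q) G →
      (((f '' F) ⊆ f '' G ∨ (f '' G) ⊆ f '' F) ↔ (F ⊆ G ∨ G ⊆ F)) := fun F G hF hG =>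
    or_congr (hf.image_subset_image_iff hF.subset_ground hG.subset_ground)
      (hf.image_subset_image_iff hG.subset_ground hF.subset_ground)
  have key : ∀ F G, IsFundamentalFlat (bandMatroid n p q) F →
      IsFundamentalFlat (bandMatroid n p q) G →
      ((IsInitial n (f '' F) ↔ IsInitial n (f '' G)) ↔ (IsInitial n F ↔ IsInitial n G)) :=
    fun F G hF hG => by
      rw [← comparable_iff (himg F hF) (himg G hG), hcomp F G hF hG,
        comparable_iff (hB.isInitial_or_isFinal hF) (hB.isInitial_or_isFinal hG)]
  -- By `key`, one flat that keeps its type makes all the others keep theirs. If there is none,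
  -- every flat changes type, vacuously when there are no flats.
  by_cases h : ∃ F, IsFundamentalFlat (bandMatroid n p q) F ∧
      (IsInitial n F ↔ IsInitial n (f '' F))
  · obtain ⟨F, hF, h⟩ := h
    refine Or.inl fun G hG => ?_
    have h1 := key F G hF hG
    have h2 := isFinal_iff (hB.isInitial_or_isFinal hG)
    have h3 := isFinal_iff (himg G hG)
    tauto
  · push Not at h
    refine Or.inr fun G hG => ?_
    have h1 := h G hG
    have h2 := isFinal_iff (hB.isInitial_or_isFinal hG)
    have h3 := isFinal_iff (himg G hG)
    tauto

/-- If the matroids are isomorphic, then the second pair of paths lies inside the first pair, or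
inside its rotation. -/
theorem IsBoundingPair.le_or_le_reverse (h : IsBoundingPair P Q) {n r : ℕ} (hn : P.length = n)
    (hn' : P'.length = n) (hr : P.count Step.north = r)
    (hr' : P'.count Step.north = r) (hB : IsStrictBand n r (height P) (height Q))
    (hB' : IsStrictBand n r (height P') (height Q'))
    (hiso : IsIsomorphic (bandMatroid n (height P) (height Q))
      (bandMatroid n (height P') (height Q'))) :
    (∀ k ≤ n, height Q' k ≤ height Q k ∧ height P k ≤ height P' k) ∨
      (∀ k ≤ n, height Q' k ≤ height P.reverse k ∧ height Q.reverse k ≤ height P' k) := by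
  obtain ⟨f, hf, he⟩ := hiso.exists_eq_map
  have hrev : ∀ k, height P.reverse k + height P (n - k) = r := by
    intro k; rw [← hn, ← hr]; exact height_reverse_add P k
  have hrev' : ∀ k, height P'.reverse k + height P' (n - k) = r := by
    intro k; rw [← hn', ← hr']; exact height_reverse_add P' k
  have hrevQ : ∀ k, height Q.reverse k + height Q (n - k) = r := by
    intro k; rw [← hn, ← hr, ← h.length_eq, ← h.count_eq]; exact height_reverse_add Q k
  have hcorner : ∀ b, 0 < b → b < n → height Q (b - 1) = height Q b →
      height Q (b + 1) = height Q b + 1 →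
      IsFundamentalFlat (bandMatroid n (height P) (height Q)) (Icc 1 b) :=
    fun b h0 hb h1 h2 => hB.isFundamentalFlat_Icc h0 hb h1 h2
  have hcorner' : ∀ b, 0 < b → b < n → height P.reverse (b - 1) = height P.reverse b →
      height P.reverse (b + 1) = height P.reverse b + 1 →
      IsFundamentalFlat (bandMatroid n (height P) (height Q)) (Ioc (n - b) n) := by
    subst hn hr
    exact fun b h0 hb h1 h2 => h.isFundamentalFlat_Ioc hB h0 hb h1 h2
  have hmap : ∀ F, IsFundamentalFlat (bandMatroid n (height P) (height Q)) F →
      IsFundamentalFlat (bandMatroid n (height P') (height Q')) (f '' F) ∧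
      (bandMatroid n (height P') (height Q')).eRk (f '' F) =
        (bandMatroid n (height P) (height Q)).eRk F ∧ (f '' F).ncard = F.ncard := by
    intro F hF
    rw [he]
    exact ⟨hF.map hf, Matroid.eRk_map _ hf hF.subset_ground,
      (hf.mono hF.subset_ground).ncard_image⟩
  have htop : ∀ {w : List Step}, w.length = n → w.count Step.north = r → height w n = r :=
    fun h1 h2 => by rw [← h2]; exact height_of_length_le h1.le
  have eQ : height Q n = r := hB.q_eq n le_rfl
  have eQ' : height Q' n = r := hB'.q_eq n le_rfl
  have eP : height P.reverse n = r := htop (by simpa using hn) (by simpa using hr)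
  have eP' : height P'.reverse n = r := htop (by simpa using hn') (by simpa using hr')
  rcases hB.preserves_or_exchanges hB' hf he with hpr | hex
  · left
    have c1 : ∀ k ≤ n, height Q' k ≤ height Q k := by
      refine le_of_eq_at_corners (height_mono _) (height_mono _) (height_succ_le _)
        (height_succ_le _) (by simp) (by omega) fun b hb0 hbn h1 h2 => ?_
      have hF := hcorner b hb0 hbn h1 h2
      obtain ⟨hF', hrk, hcard⟩ := hmap _ hF
      -- The image is an initial interval of the same size and rank, so it is `Icc 1 b` itself, and
      -- comparing ranks gives `height Q' b = height Q b`.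
      obtain ⟨b', hb0', hbn', hb⟩ := (hpr _ hF).1 ⟨b, hb0, hbn, rfl⟩
      rw [hb] at hF' hrk hcard
      rw [ncard_Icc_nat, ncard_Icc_nat] at hcard
      obtain rfl : b' = b := by omega
      rw [hB.eRk_Icc hb0 hF, hB'.eRk_Icc hb0 hF'] at hrk
      exact_mod_cast hrk
    have c2 : ∀ k ≤ n, height P'.reverse k ≤ height P.reverse k := by
      refine le_of_eq_at_corners (height_mono _) (height_mono _) (height_succ_le _)
        (height_succ_le _) (by simp) (by omega) fun b hb0 hbn h1 h2 => ?_
      have hF := hcorner' b hb0 hbn h1 h2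
      obtain ⟨hF', hrk, hcard⟩ := hmap _ hF
      obtain ⟨a, ha0, han, ha⟩ := (hpr _ hF).2 ⟨n - b, by omega, by omega, rfl⟩
      rw [ha] at hF' hrk hcard
      rw [ncard_Ioc_nat, ncard_Ioc_nat] at hcard
      obtain rfl : a = n - b := by omega
      have e1 := hB.eRk_Ioc ha0 han hF
      have e2 := hB'.eRk_Ioc ha0 han hF'
      rw [hrk] at e2
      -- The common rank has to be finite before it can be cancelled.
      have ht : (bandMatroid n (height P) (height Q)).eRk (Ioc (n - b) n) ≠ ⊤ := fun ht => by
        rw [ht, top_add] at e1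
        exact ENat.top_ne_natCast _ e1
      obtain ⟨s, hs⟩ := ENat.ne_top_iff_exists.1 ht
      rw [← hs] at e1 e2
      have e3 : s + height P (n - b) = r := by exact_mod_cast e1
      have e4 : s + height P' (n - b) = r := by exact_mod_cast e2
      have e5 := hrev b
      have e6 := hrev' b
      omega
    refine fun k hk => ⟨c1 k hk, ?_⟩
    have e1 := c2 (n - k) (by omega)
    have e2 := hrev (n - k)
    have e3 := hrev' (n - k)
    rw [show n - (n - k) = k by omega] at e2 e3
    omega
  · right
    -- Now an initial flat of size `b` goes to the final interval of the same size, whose rank `r -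
    -- height P' (n - b)` is the height of `P'.reverse` at `b`.
    have c1 : ∀ k ≤ n, height P'.reverse k ≤ height Q k := by
      refine le_of_eq_at_corners (height_mono _) (height_mono _) (height_succ_le _)
        (height_succ_le _) (by simp) (by omega) fun b hb0 hbn h1 h2 => ?_
      have hF := hcorner b hb0 hbn h1 h2
      obtain ⟨hF', hrk, hcard⟩ := hmap _ hF
      obtain ⟨a, ha0, han, ha⟩ := (hex _ hF).1 ⟨b, hb0, hbn, rfl⟩
      rw [ha] at hF' hrk hcard
      rw [ncard_Icc_nat, ncard_Ioc_nat] at hcard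
      obtain rfl : a = n - b := by omega
      have e2 := hB'.eRk_Ioc ha0 han hF'
      rw [hrk, hB.eRk_Icc hb0 hF] at e2
      have e3 := hrev' b
      have e4 : height Q b + height P' (n - b) = r := by exact_mod_cast e2
      omega
    have c2 : ∀ k ≤ n, height Q' k ≤ height P.reverse k := by
      refine le_of_eq_at_corners (height_mono _) (height_mono _) (height_succ_le _)
        (height_succ_le _) (by simp) (by omega) fun b hb0 hbn h1 h2 => ?_
      have hF := hcorner' b hb0 hbn h1 h2
      obtain ⟨hF', hrk, hcard⟩ := hmap _ hF
      obtain ⟨b', hb0', hbn', hb⟩ := (hex _ hF).2 ⟨n - b, by omega, by omega, rfl⟩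
      rw [hb] at hF' hrk hcard
      rw [ncard_Icc_nat, ncard_Ioc_nat] at hcard
      obtain rfl : b' = b := by omega
      have e1 := hB.eRk_Ioc (by omega) (by omega) hF
      rw [← hrk, hB'.eRk_Icc hb0 hF'] at e1
      have e3 := hrev b'
      have e4 : height Q' b' + height P (n - b') = r := by exact_mod_cast e1
      omega
    refine fun k hk => ⟨c2 k hk, ?_⟩
    have e1 := c1 (n - k) (by omega)
    have e2 := hrevQ k
    have e3 := hrev' (n - k)
    rw [show n - (n - k) = k by omega] at e3
    omega

theorem eq_of_height_eq_of_le {n : ℕ} {v w : List Step} (hv : v.length = n) (hw : w.length = n)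
    (h : ∀ k ≤ n, height v k = height w k) : v = w := by
  refine ext_height (hv.trans hw.symm) fun k => ?_
  rcases le_total k n with hk | hk
  · exact h k hk
  · have := h n le_rfl
    rw [height_of_length_le hv.le, height_of_length_le hw.le] at this
    rw [height_of_length_le (by omega), height_of_length_le (by omega), this]

/-- Two connected lattice path matroids are isomorphic only if the bounding paths agree up to a
half turn. -/
theorem IsBoundingPair.eq_or_eq_reverse (h : IsBoundingPair P Q)
    (hconn : IsConnected (latticePathMatroid P Q)) (h' : IsBoundingPair P' Q')
    (hiso : IsIsomorphic (latticePathMatroid P' Q') (latticePathMatroid P Q)) :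
    (P' = P ∧ Q' = Q) ∨ (P' = Q.reverse ∧ Q' = P.reverse) := by
  rw [latticePathMatroid_eq h] at hconn hiso
  rw [latticePathMatroid_eq h'] at hiso
  obtain ⟨f, hf, he⟩ := hiso.symm.exists_eq_map
  have hlen : P'.length = P.length := by
    have h1 := congrArg (fun M => M.E.ncard) he
    simp only [Matroid.map_ground, hf.ncard_image] at h1
    simpa using h1
  have hcount : P'.count Step.north = P.count Step.north := by
    have h1 := congrArg Matroid.eRank he
    rw [Matroid.eRank_map, h.isBand.eRank_eq, h'.isBand.eRank_eq] at h1
    exact_mod_cast h1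
  have hlQ := h.length_eq
  have hlQ' := h'.length_eq
  have hconn' := hconn.map hf
  rw [← he] at hconn'
  have hBd := h.isBand
  have hBd' := h'.isBand
  rw [hlen] at hiso hBd' hconn' hlQ'
  rw [hcount] at hBd'
  -- With at most one step, the common endpoint determines the path.
  rcases Nat.lt_or_ge P.length 2 with hn | hn
  · have hh : ∀ k ≤ P.length, k = 0 ∨ k = P.length := by omega
    refine Or.inl ⟨eq_of_height_eq_of_le hlen rfl fun k hk => ?_,
      eq_of_height_eq_of_le hlQ' hlQ fun k hk => ?_⟩
    · rcases hh k hk with rfl | rfl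
      · simp
      · rw [hBd.p_eq _ le_rfl, hBd'.p_eq _ le_rfl]
    · rcases hh k hk with rfl | rfl
      · simp
      · rw [hBd.q_eq _ le_rfl, hBd'.q_eq _ le_rfl]
  have hB : IsStrictBand _ _ _ _ := ⟨hBd, hn, fun k => hBd.lt_of_isConnected hconn⟩
  have hB' : IsStrictBand _ _ _ _ := ⟨hBd', hn, fun k => hBd'.lt_of_isConnected hconn'⟩
  have hrP : ∀ k, height P.reverse k + height P (P.length - k) = P.count Step.north :=
    height_reverse_add P
  have hrQ : ∀ k, height Q.reverse k + height Q (P.length - k) = P.count Step.north := by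
    rw [← hlQ, ← h.count_eq]; exact height_reverse_add Q
  have hrP' : ∀ k, height P'.reverse k + height P' (P.length - k) = P.count Step.north := by
    rw [← hlen, ← hcount]; exact height_reverse_add P'
  have hrQ' : ∀ k, height Q'.reverse k + height Q' (P.length - k) = P.count Step.north := by
    rw [← hlQ', ← hcount, ← h'.count_eq]; exact height_reverse_add Q'
  have hPr : P.reverse.length = P.length := List.length_reverse
  have hQr : Q.reverse.length = P.length := by rw [List.length_reverse, hlQ]
  -- The two directions choose between the alternatives independently, so mixed cases must be
  -- handled too.
  have key1 := h.le_or_le_reverse rfl hlen rfl hcount hB hB' hiso.symm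
  have key2 := h'.le_or_le_reverse hlen rfl hcount rfl hB' hB hiso
  generalize hlP : P.length = n at *
  have hsub : ∀ k ≤ n, n - (n - k) = k := by omega
  rcases key1 with key1 | key1 <;> rcases key2 with key2 | key2
  · left
    exact ⟨eq_of_height_eq_of_le hlen hlP fun k hk => by
        have := key1 k hk; have := key2 k hk; omega,
      eq_of_height_eq_of_le hlQ' hlQ fun k hk => by
        have := key1 k hk; have := key2 k hk; omega⟩
  -- Whenever a rotation occurs, the inequalities close up into a cycle. For example, `Q'` inside
  -- `Q` and `Q` inside the rotated second pair give `Q' ≤ Q ≤ P'.reverse ≤ P.reverse ≤ Q'` in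
  -- height.
  all_goals
    right
    refine ⟨eq_of_height_eq_of_le hlen hQr fun k hk => ?_,
      eq_of_height_eq_of_le hlQ' hPr fun k hk => ?_⟩ <;>
    · have a1 := key1 k hk
      have a2 := key2 k hk
      have a3 := key1 (n - k) (Nat.sub_le n k)
      have a4 := key2 (n - k) (Nat.sub_le n k)
      have b1 := hrP k
      have b2 := hrQ k
      have b3 := hrP' k
      have b4 := hrQ' k
      have c1 := hrP (n - k)
      have c2 := hrQ (n - k)
      have c3 := hrP' (n - k)
      have c4 := hrQ' (n - k)
      rw [hsub k hk] at c1 c2 c3 c4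
      omega

end Comparison

end LatticePath

theorem theorem5p5 (P Q : List LatticePath.Step)
    (hPQ : LatticePath.IsBoundingPair P Q)
    (hconn : LatticePath.IsConnected (LatticePath.latticePathMatroid P Q))
    (P' Q' : List LatticePath.Step) :
    (LatticePath.IsBoundingPair P' Q' ∧
      LatticePath.IsIsomorphic (LatticePath.latticePathMatroid P' Q')
        (LatticePath.latticePathMatroid P Q)) ↔
    ((P' = P ∧ Q' = Q) ∨ (P' = Q.reverse ∧ Q' = P.reverse)) := by
  constructor
  · rintro ⟨h', hiso⟩
    exact hPQ.eq_or_eq_reverse hconn h' hiso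
  · rintro (⟨rfl, rfl⟩ | ⟨rfl, rfl⟩)
    · exact ⟨hPQ, LatticePath.isIsomorphic_refl _⟩
    · exact ⟨hPQ.reverse, hPQ.isIsomorphic_reverse⟩
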